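/- Consider a finite two-player zero-sum extensive-form game with perfect recall (chance moves allowed). Let $\mathcal I_i$ be the set of information sets at which player $i$ acts, $|\mathcal I|=|\mathcal I_1|+|\mathcal I_2|$, $|\mathcal A|=\max_{i,\,I\in\mathcal I_i}|\mathcal A(I)|$ the largest number of actions at an information set of a player, $\Delta_i=\max_z u_i(z)-\min_z u_i(z)$ over terminal histories $z$, and $\Delta=\max_i\Delta_i$. For a strategy profile $\sigma$ write $\pi_i^\sigma(h)$ and $\pi_{-i}^\sigma(h)$ for the contribution of player $i$, respectively of the opponent and chance, to the probability of reaching the history $h$, $\pi^\sigma(h,z)$ for the probability of getting from $h$ to $z$ (zero if $h$ is not a prefix of $z$), and $\pi_i^\sigma(I)=\sum_{h\in I}\pi_i^\sigma(h)$. For $I\in\mathcal I_i$ and $a\in\mathcal A(I)$ let $$v_i^\sigma(I)=\sum_{h\in I}\pi_{-i}^\sigma(h)\sum_z\pi^\sigma(h,z)u_i(z),\qquad v_i^\sigma(I,a)=\sum_{h\in I}\pi_{-i}^\sigma(h)\sum_z\pi^\sigma(h\cdot a,z)u_i(z).$$ HS-DCFR with simultaneous updates and hyperparameters $\alpha_t,\beta_t,\gamma_t$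 at iteration $t$ is the following procedure. Start with $R_i^0=C_i^0=0$. On iteration $t+1$ ($t=0,1,2,\dots$), for both players $i$ at once and all $I\in\mathcal I_i$, $a\in\mathcal A(I)$, let $\sigma_i^{t+1}(I,a)=\max(R_i^t(I,a),0)/\sum_{a'\in\mathcal A(I)}\max(R_i^t(I,a'),0)$ if the denominator is positive and $\sigma_i^{t+1}(I,a)=1/|\mathcal A(I)|$ otherwise; then, with $r_i^{t+1}(I,a)=v_i^{\sigma^{t+1}}(I,a)-v_i^{\sigma^{t+1}}(I)$, set $$R_i^{t+1}(I,a)=R_i^t(I,a)\,\frac{t^{\alpha_{t+1}}}{t^{\alpha_{t+1}}+1}+r_i^{t+1}(I,a)\ \text{ if } R_i^t(I,a)>0,\qquad R_i^{t+1}(I,a)=R_i^t(I,a)\,\frac{t^{\beta_{t+1}}}{t^{\beta_{t+1}}+1}+r_i^{t+1}(I,a)\ \text{ otherwise},$$ $$C_i^{t+1}(I,a)=C_i^t(I,a)\Big(\frac t{t+1}\Big)^{\gamma_{t+1}}+\pi_i^{\sigma^{t+1}}(I)\,\sigma_i^{t+1}(I,a)$$ (for $t=0$ the discounted terms are $0$).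 The weighted average strategy profile $\bar\sigma$ after $T$ iterations is $\bar\sigma_i(I,a)=C_i^T(I,a)/\sum_{a'\in\mathcal A(I)}C_i^T(I,a')$, and uniform on $\mathcal A(I)$ where this denominator is $0$. **Theorem 3.1.** Let $T\ge1$ and suppose $\alpha_t\in[1,5]$, $\beta_t\in[-5,0]$ and $\gamma_t\in[0,U]$ for all $t=1,\dots,T$. Then the weighted average strategy profile $\bar\sigma$ after $T$ iterations of HS-DCFR with simultaneous updates is an $\varepsilon$-Nash equilibrium with $$\varepsilon=(U+1)\,\Delta\,|\mathcal I|\left(\tfrac83\sqrt{|\mathcal A|}+\tfrac2{\sqrt T}\right)\Big/\sqrt T .$$ That is, $\bar\sigma$ is a strategy profile from which no player can gain more than $\varepsilon$ in expected utility by a unilateral deviation, and moreover each player's exploitability $e(\bar\sigma_i)=u_i(\sigma_i^*,\mathrm{BR}(\sigma_i^*))-u_i(\bar\sigma_i,\mathrm{BR}(\bar\sigma_i))$ is at most $\varepsilon$, where $\sigma^*$ is any Nash equilibrium and $\mathrm{BR}(\cdot)$ any best response of the opponent. -/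

import Mathlib

noncomputable section

/-- A finite game tree: a finite set of histories (finite sequences of actions) which contains the
empty history and is closed under prefixes. The history `h · a` is `h ++ [a]`. -/
structure GameTree (A : Type*) where
  hist : Finset (List A)
  nil_mem : [] ∈ hist
  prefix_closed : ∀ h a, h ++ [a] ∈ hist → h ∈ hist

namespace GameTree

variable {A : Type*} [Fintype A] [DecidableEq A]

/-- The actions available at the history `h`. -/
def actions (G : GameTree A) (h : List A) : Finset A :=
  Finset.univ.filter fun a => h ++ [a] ∈ G.hist

/-- The terminal histories: no action is available. -/
def terminal (G : GameTree A) : Finset (List A) :=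
  G.hist.filter fun h => G.actions h = ∅

theorem terminal_nonempty (G : GameTree A) : G.terminal.Nonempty := by
  obtain ⟨h, hh, hmax⟩ := Finset.exists_max_image G.hist List.length ⟨[], G.nil_mem⟩
  refine ⟨h, Finset.mem_filter.2 ⟨hh, ?_⟩⟩
  refine Finset.eq_empty_of_forall_notMem fun a ha => ?_
  have h1 := hmax _ (Finset.mem_filter.1 ha).2
  simp at h1

end GameTree

/-- A finite two-player zero-sum extensive-form game with chance moves. The players are the
elements of `Fin 2`. `turn h = none` means that chance moves at `h`. At a history where a player
moves, `info h` is (the name of) that player's information set containing `h`. The values of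
`turn`, `info`, `chance`, `utility` at sequences where they make no sense are irrelevant. -/
structure ZeroSumGame (A K : Type*) [Fintype A] [DecidableEq A] extends GameTree A where
  turn : List A → Option (Fin 2)
  info : List A → K
  info_actions : ∀ h ∈ toGameTree.hist, ∀ h' ∈ toGameTree.hist,
    (toGameTree.actions h).Nonempty → (toGameTree.actions h').Nonempty →
    turn h ≠ none → turn h = turn h' → info h = info h' →
    toGameTree.actions h = toGameTree.actions h'
  /-- the fixed strategy of chance -/
  chance : List A → A → ℝ
  chance_nonneg : ∀ h ∈ toGameTree.hist, turn h = none →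
    ∀ a ∈ toGameTree.actions h, 0 ≤ chance h a
  chance_sum : ∀ h ∈ toGameTree.hist, turn h = none → (toGameTree.actions h).Nonempty →
    ∑ a ∈ toGameTree.actions h, chance h a = 1
  utility : Fin 2 → List A → ℝ
  zero_sum : ∀ z ∈ toGameTree.terminal, utility 0 z + utility 1 z = 0

namespace ZeroSumGame

variable {A K : Type*} [Fintype A] [DecidableEq A] [DecidableEq K]

/-- The nonterminal histories at which player `i` moves. -/
def decisionNodes (G : ZeroSumGame A K) (i : Fin 2) : Finset (List A) :=
  G.hist.filter fun h => (G.actions h).Nonempty ∧ G.turn h = some i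

/-- The set `𝓘ᵢ` of information sets of player `i`. -/
def infoSets (G : ZeroSumGame A K) (i : Fin 2) : Finset K :=
  (G.decisionNodes i).image G.info

/-- The histories in the information set `I` of player `i`. -/
def members (G : ZeroSumGame A K) (i : Fin 2) (I : K) : Finset (List A) :=
  (G.decisionNodes i).filter fun h => G.info h = I

/-- `𝒜(I)`; all members of `I` have the same available actions. -/
def infoActions (G : ZeroSumGame A K) (i : Fin 2) (I : K) : Finset A :=
  (G.members i I).biUnion G.actions

/-- `|𝓘| = ∑ᵢ |𝓘ᵢ|`. -/
def numInfoSets (G : ZeroSumGame A K) : ℕ :=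
  ∑ i, (G.infoSets i).card

/-- `|𝒜|`, the largest number of actions at an information set of either player. -/
def maxActions (G : ZeroSumGame A K) : ℕ :=
  Finset.univ.sup fun i => (G.infoSets i).sup fun I => (G.infoActions i I).card

/-- The range of utilities `Δᵢ` of player `i`. -/
def utilityRange (G : ZeroSumGame A K) (i : Fin 2) : ℝ :=
  G.terminal.sup' G.terminal_nonempty (G.utility i) -
    G.terminal.inf' G.terminal_nonempty (G.utility i)

/-- `Δ = maxᵢ Δᵢ`. -/
def maxRange (G : ZeroSumGame A K) : ℝ :=
  max (G.utilityRange 0) (G.utilityRange 1)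

/-- The pairs (information set, action) of player `i` met when the actions `l` are taken in order
starting from the history `g`. -/
def ownSequence (G : ZeroSumGame A K) (i : Fin 2) : List A → List A → List (K × A)
  | _, [] => []
  | g, a :: l =>
    if G.turn g = some i then (G.info g, a) :: G.ownSequence i (g ++ [a]) l
    else G.ownSequence i (g ++ [a]) l

/-- Perfect recall: two histories in the same information set of a player agree in that player's
past information sets and actions. -/
def PerfectRecall (G : ZeroSumGame A K) : Prop :=
  ∀ i, ∀ h ∈ G.decisionNodes i, ∀ h' ∈ G.decisionNodes i, G.info h = G.info h' →
    G.ownSequence i [] h = G.ownSequence i [] h'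

/-- `s I a` is a (behavioral) strategy of player `i`: a probability distribution on `𝒜(I)` for
every `I ∈ 𝓘ᵢ` (other values of `s` are irrelevant). -/
def IsStrategy (G : ZeroSumGame A K) (i : Fin 2) (s : K → A → ℝ) : Prop :=
  ∀ I ∈ G.infoSets i, (∀ a ∈ G.infoActions i I, 0 ≤ s I a) ∧ ∑ a ∈ G.infoActions i I, s I a = 1

/-- Strategy profiles. -/
def IsProfile (G : ZeroSumGame A K) (σ : Fin 2 → K → A → ℝ) : Prop :=
  ∀ i, G.IsStrategy i (σ i)

/-- The probability of the action `a` at the history `h` under the profile `σ`. -/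
def actProb (G : ZeroSumGame A K) (σ : Fin 2 → K → A → ℝ) (h : List A) (a : A) : ℝ :=
  match G.turn h with
  | none => G.chance h a
  | some i => σ i (G.info h) a

/-- The factor contributed by player `i` alone. -/
def ownProb (G : ZeroSumGame A K) (σ : Fin 2 → K → A → ℝ) (i : Fin 2) (h : List A) (a : A) : ℝ :=
  if G.turn h = some i then G.actProb σ h a else 1

/-- The factor contributed by everybody except player `i` (so by the opponent and chance). -/
def otherProb (G : ZeroSumGame A K) (σ : Fin 2 → K → A → ℝ) (i : Fin 2) (h : List A) (a : A) : ℝ :=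
  if G.turn h = some i then 1 else G.actProb σ h a

/-- The product of the factors `f h a` along the path that starts at the history `g` and takes the
actions `l` in order. -/
def pathProd (f : List A → A → ℝ) : List A → List A → ℝ
  | _, [] => 1
  | g, a :: l => f g a * pathProd f (g ++ [a]) l

/-- The history reach probability `π^σ(h)`. -/
def reach (G : ZeroSumGame A K) (σ : Fin 2 → K → A → ℝ) (h : List A) : ℝ :=
  pathProd (G.actProb σ) [] h

/-- `πᵢ^σ(h)`. -/
def ownReach (G : ZeroSumGame A K) (σ : Fin 2 → K → A → ℝ) (i : Fin 2) (h : List A) : ℝ :=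
  pathProd (G.ownProb σ i) [] h

/-- `π₋ᵢ^σ(h)`. -/
def otherReach (G : ZeroSumGame A K) (σ : Fin 2 → K → A → ℝ) (i : Fin 2) (h : List A) : ℝ :=
  pathProd (G.otherProb σ i) [] h

/-- The interval reach probability `π^σ(h, z)`, the probability of getting from `h` to `z`
(zero unless `h` is a prefix of `z`). -/
def intervalReach (G : ZeroSumGame A K) (σ : Fin 2 → K → A → ℝ) (h z : List A) : ℝ :=
  if h <+: z then pathProd (G.actProb σ) h (z.drop h.length) else 0

/-- `πᵢ^σ(I) = ∑_{h ∈ I} πᵢ^σ(h)`. -/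
def ownInfoReach (G : ZeroSumGame A K) (σ : Fin 2 → K → A → ℝ) (i : Fin 2) (I : K) : ℝ :=
  ∑ h ∈ G.members i I, G.ownReach σ i h

/-- The expected utility `uᵢ(σ)`. -/
def expUtility (G : ZeroSumGame A K) (i : Fin 2) (σ : Fin 2 → K → A → ℝ) : ℝ :=
  ∑ z ∈ G.terminal, G.reach σ z * G.utility i z

/-- The counterfactual value `vᵢ^σ(I)`. -/
def cfValue (G : ZeroSumGame A K) (σ : Fin 2 → K → A → ℝ) (i : Fin 2) (I : K) : ℝ :=
  ∑ h ∈ G.members i I, G.otherReach σ i h *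
    ∑ z ∈ G.terminal, G.intervalReach σ h z * G.utility i z

/-- The counterfactual value `vᵢ^σ(I, a)`. -/
def cfActionValue (G : ZeroSumGame A K) (σ : Fin 2 → K → A → ℝ) (i : Fin 2) (I : K) (a : A) : ℝ :=
  ∑ h ∈ G.members i I, G.otherReach σ i h *
    ∑ z ∈ G.terminal, G.intervalReach σ (h ++ [a]) z * G.utility i z

/-- The instantaneous regret of player `i` for not choosing `a` at `I` when `σ` is played. -/
def instRegret (G : ZeroSumGame A K) (σ : Fin 2 → K → A → ℝ) (i : Fin 2) (I : K) (a : A) : ℝ :=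
  G.cfActionValue σ i I a - G.cfValue σ i I

/-- Regret matching on the cumulative regrets `R`. -/
def regretMatching (G : ZeroSumGame A K) (R : Fin 2 → K → A → ℝ) (i : Fin 2) (I : K) (a : A) : ℝ :=
  if 0 < ∑ a' ∈ G.infoActions i I, max (R i I a') 0 then
    max (R i I a) 0 / ∑ a' ∈ G.infoActions i I, max (R i I a') 0
  else 1 / ((G.infoActions i I).card : ℝ)

/-- The cumulative discounted regret `Rᵢᵗ(I, a)` of HS-DCFR with simultaneous updates after `t`
iterations. On iteration `t + 1` both players play the regret-matching strategy for `Rᵗ`, and the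
hyperparameters in force are `α (t + 1)` and `β (t + 1)`. -/
def cumRegret (G : ZeroSumGame A K) (α β : ℕ → ℝ) : ℕ → Fin 2 → K → A → ℝ
  | 0 => fun _ _ _ => 0
  | t + 1 => fun i I a =>
    G.cumRegret α β t i I a *
      (if 0 < G.cumRegret α β t i I a then (t : ℝ) ^ α (t + 1) / ((t : ℝ) ^ α (t + 1) + 1)
        else (t : ℝ) ^ β (t + 1) / ((t : ℝ) ^ β (t + 1) + 1)) +
    G.instRegret (G.regretMatching (G.cumRegret α β t)) i I a

/-- The strategy profile `σᵗ⁺¹` played on iteration `t + 1` (`t = 0, 1, …`). -/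
def iterate (G : ZeroSumGame A K) (α β : ℕ → ℝ) (t : ℕ) : Fin 2 → K → A → ℝ :=
  G.regretMatching (G.cumRegret α β t)

/-- The cumulative discounted strategy `Cᵢᵗ(I, a)` after `t` iterations. -/
def cumStrategy (G : ZeroSumGame A K) (α β γ : ℕ → ℝ) : ℕ → Fin 2 → K → A → ℝ
  | 0 => fun _ _ _ => 0
  | t + 1 => fun i I a =>
    G.cumStrategy α β γ t i I a * ((t : ℝ) / ((t : ℝ) + 1)) ^ γ (t + 1) +
    G.ownInfoReach (G.iterate α β t) i I * G.iterate α β t i I a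

/-- The weighted average strategy profile after `T` iterations: the normalized cumulative strategy
(uniform at the information sets where the cumulative strategy vanishes). -/
def avgStrategy (G : ZeroSumGame A K) (α β γ : ℕ → ℝ) (T : ℕ) : Fin 2 → K → A → ℝ :=
  fun i I a =>
    if 0 < ∑ a' ∈ G.infoActions i I, G.cumStrategy α β γ T i I a' then
      G.cumStrategy α β γ T i I a / ∑ a' ∈ G.infoActions i I, G.cumStrategy α β γ T i I a'
    else 1 / ((G.infoActions i I).card : ℝ)

/-- No player can gain more than `ε` by a unilateral deviation from the profile `σ`. -/
def IsEpsNash (G : ZeroSumGame A K) (ε : ℝ) (σ : Fin 2 → K → A → ℝ) : Prop :=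
  G.IsProfile σ ∧ ∀ i s, G.IsStrategy i s →
    G.expUtility i (Function.update σ i s) ≤ G.expUtility i σ + ε

/-- Nash equilibrium. -/
def IsNash (G : ZeroSumGame A K) (σ : Fin 2 → K → A → ℝ) : Prop :=
  G.IsEpsNash 0 σ

/-- `s` is a best response of player `i` to the strategy of the other player in `σ`. -/
def IsBestResponse (G : ZeroSumGame A K) (σ : Fin 2 → K → A → ℝ) (i : Fin 2)
    (s : K → A → ℝ) : Prop :=
  G.IsStrategy i s ∧ ∀ s', G.IsStrategy i s' →
    G.expUtility i (Function.update σ i s') ≤ G.expUtility i (Function.update σ i s)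

/-- The exploitability `e(σᵢ) = uᵢ(σ*ᵢ, BR(σ*ᵢ)) - uᵢ(σᵢ, BR(σᵢ))` of the strategy of player `i`
in `σ` is at most `ε`, whichever equilibrium `σ*` and best responses of the opponent `i.rev`
of `i` are used to evaluate it. -/
def ExploitabilityLE (G : ZeroSumGame A K) (ε : ℝ) (σ : Fin 2 → K → A → ℝ) (i : Fin 2) : Prop :=
  ∀ σs, G.IsNash σs → ∀ bs b, G.IsBestResponse σs i.rev bs → G.IsBestResponse σ i.rev b →
    G.expUtility i (Function.update σs i.rev bs) - G.expUtility i (Function.update σ i.rev b) ≤ ε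

end ZeroSumGame

end

/-!
On iteration `t` let `x t` be the instantaneous regret of an action at an information set, and let
`W` be its sum weighted as in the average strategy, so that `W (t + 1) = g t * W t + x t` with
`g t = (t / (t + 1)) ^ γ (t + 1)` (`discSum`). The cumulative regret `R` of the algorithm obeys the
same recursion, with a discount factor that depends on the sign of `R`. Hence `W - R` changes on
every step by the averaging discount and by a multiple of `R` itself, and `W` is small as soon as
both signs of `R` are under control (`discSum_regret_le`):

* Negative regrets are at least halved on every step, so they stay above `-2 Δ`. A step on
  which `R` is negative takes `W - R` at most to a convex combination of `W - R` and `2 Δ`.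
* Positive regrets are multiplied by some `d t ∈ [t / (t + 1), 1]`, and by Blackwell's argument
  their squares sum to at most `Δ ^ 2 * |A| * V t`, where `V (t + 1) = d t ^ 2 * V t + 1`
  (`sum_sq_pos_le`). What they contribute to `W - R` is at most `(1 - d t) * √(V t)` per step, in
  units of `Δ * √|A|`. Since `V t ≥ t / 3`, the amounts `√(V T) + ∑ (1 - d t) * √(V t)` add up to
  at most `8 / 3 * √T` (`sqrt_potential_succ_sub_le`).

No monotonicity of the averaging weights relative to the regret weights is needed, which is what
allows the exponents to vary freely. The weights of the average strategy have total at least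
`T / (U + 1)` (`div_le_discSum_one`).

The rest is counterfactual regret minimization. The gain from a deviation telescopes along the tree
into one-step gains (`ZeroSumGame.expUtility_update_sub`), which under perfect recall group into the
regrets at the information sets (`ZeroSumGame.PerfectRecall.discSum_gain_le`). The average strategy
realizes the weighted average of the iterates
(`ZeroSumGame.PerfectRecall.ownReach_avgStrategy`), so that in a zero-sum game any two deviations
from it gain at most the sum of the average regrets of the players
(`ZeroSumGame.PerfectRecall.expUtility_sub_le`). With one trivial deviation this is the equilibrium
property, and with two it is the bound on the exploitability.
-/

set_option linter.unusedSectionVars false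

/-! ### Discounted sums -/

/-- The discounted sum of the sequence `x`: on every step the sum accumulated so far is
multiplied by the current discount factor and the current term is added undiscounted. -/
noncomputable def discSum (g x : ℕ → ℝ) : ℕ → ℝ
  | 0 => 0
  | n + 1 => discSum g x n * g n + x n

section DiscSum

variable {g : ℕ → ℝ}

theorem discSum_mul_left (c : ℝ) (x : ℕ → ℝ) (n : ℕ) :
    discSum g (fun t => c * x t) n = c * discSum g x n := by
  induction n with
  | zero => simp [discSum]
  | succ n ih => simp only [discSum, ih]; ring

theorem discSum_add (x y : ℕ → ℝ) (n : ℕ) :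
    discSum g (fun t => x t + y t) n = discSum g x n + discSum g y n := by
  induction n with
  | zero => simp [discSum]
  | succ n ih => simp only [discSum, ih]; ring

theorem discSum_sum {ι : Type*} (s : Finset ι) (x : ι → ℕ → ℝ) (n : ℕ) :
    discSum g (fun t => ∑ j ∈ s, x j t) n = ∑ j ∈ s, discSum g (x j) n := by
  induction n with
  | zero => simp [discSum]
  | succ n ih => simp only [discSum, ih, Finset.sum_add_distrib, Finset.sum_mul]

theorem discSum_mono (hg : ∀ t, 0 ≤ g t) {x y : ℕ → ℝ} (hxy : ∀ t, x t ≤ y t) (n : ℕ) :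
    discSum g x n ≤ discSum g y n := by
  induction n with
  | zero => simp [discSum]
  | succ n ih =>
    exact add_le_add (mul_le_mul_of_nonneg_right ih (hg n)) (hxy n)

theorem discSum_nonneg (hg : ∀ t, 0 ≤ g t) {x : ℕ → ℝ} (hx : ∀ t, 0 ≤ x t) (n : ℕ) :
    0 ≤ discSum g x n := by
  induction n with
  | zero => simp [discSum]
  | succ n ih => exact add_nonneg (mul_nonneg ih (hg n)) (hx n)

/-- With averaging exponents at most `U`, the averaging weights have total at least
`T / (U + 1)`, as for the weights `(t / T) ^ U`. -/
theorem div_le_discSum_one {γ : ℕ → ℝ} {U : ℝ} {T : ℕ} (hU : 0 ≤ U)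
    (hγ : ∀ t ∈ Finset.Icc 1 T, γ t ≤ U) :
    (T : ℝ) / (U + 1) ≤
      discSum (fun t => ((t : ℝ) / ((t : ℝ) + 1)) ^ γ (t + 1)) (fun _ => 1) T := by
  suffices h : ∀ n ≤ T, (n : ℝ) / (U + 1) ≤
      discSum (fun t => ((t : ℝ) / ((t : ℝ) + 1)) ^ γ (t + 1)) (fun _ => 1) n from h T le_rfl
  intro n
  induction n with
  | zero => intro _; simp [discSum]
  | succ n ih =>
    intro hn
    have ih' := ih (by omega)
    have hU1 : 0 < U + 1 := by linarith
    rw [div_le_iff₀ hU1] at ih' ⊢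
    simp only [discSum]
    set P := discSum (fun t => ((t : ℝ) / ((t : ℝ) + 1)) ^ γ (t + 1)) (fun _ => 1) n with hP
    rcases Nat.eq_zero_or_pos n with h0 | h0
    · subst h0
      have : P = 0 := by simp [hP, discSum]
      rw [this]; push_cast; linarith
    · have hn0 : (0 : ℝ) < n := by exact_mod_cast h0
      have hbase : (0 : ℝ) < (n : ℝ) / ((n : ℝ) + 1) := by positivity
      have hle1 : (n : ℝ) / ((n : ℝ) + 1) ≤ 1 := by
        rw [div_le_one (by positivity)]; linarith
      have h1 : ((n : ℝ) / ((n : ℝ) + 1)) ^ U ≤ ((n : ℝ) / ((n : ℝ) + 1)) ^ γ (n + 1) :=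
        Real.rpow_le_rpow_of_exponent_ge hbase hle1
          (hγ (n + 1) (Finset.mem_Icc.2 ⟨by omega, hn⟩))
      -- `(n / (n + 1)) ^ U ≥ exp (-U / n) ≥ 1 - U / n`
      have h2 : 1 - U / n ≤ ((n : ℝ) / ((n : ℝ) + 1)) ^ U := by
        rw [Real.rpow_def_of_pos hbase]
        have hlog : -(1 / (n : ℝ)) ≤ Real.log ((n : ℝ) / ((n : ℝ) + 1)) := by
          have := Real.one_sub_inv_le_log_of_pos hbase
          have e : 1 - ((n : ℝ) / ((n : ℝ) + 1))⁻¹ = -(1 / (n : ℝ)) := by field_simp; ring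
          rwa [e] at this
        have h3 := Real.add_one_le_exp (Real.log ((n : ℝ) / ((n : ℝ) + 1)) * U)
        have h4 := mul_le_mul_of_nonneg_right hlog hU
        have e : U / n = 1 / (n : ℝ) * U := by ring
        rw [e]; linarith
      have h5 : (0 : ℝ) ≤ ((n : ℝ) / ((n : ℝ) + 1)) ^ γ (n + 1) := by positivity
      have h6 := mul_le_mul_of_nonneg_right ih' h5
      have h7 := mul_le_mul_of_nonneg_left (h2.trans h1) hn0.le
      have h8 : (n : ℝ) * (1 - U / n) = n - U := by field_simp
      push_cast
      nlinarith

end DiscSum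

/-! ### Growth of the squared positive regrets -/

section Potential

/-- The growth rate of the squared positive regrets: `V (t + 1) = d t ^ 2 * V t + 1`, where `d` is
the discount factor of the positive regrets. -/
noncomputable def potential (d : ℕ → ℝ) : ℕ → ℝ
  | 0 => 0
  | t + 1 => d t ^ 2 * potential d t + 1

theorem div_three_le_potential {d : ℕ → ℝ} {T : ℕ}
    (hd : ∀ t < T, (t : ℝ) / ((t : ℝ) + 1) ≤ d t) (n : ℕ) (hn : n ≤ T) :
    (n : ℝ) / 3 ≤ potential d n := by
  induction n with
  | zero => simp [potential]
  | succ n ih =>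
    have ih' := ih (by omega)
    have h0 : (0 : ℝ) ≤ (n : ℝ) / ((n : ℝ) + 1) := by positivity
    have h1 : ((n : ℝ) / ((n : ℝ) + 1)) ^ 2 ≤ d n ^ 2 := pow_le_pow_left₀ h0 (hd n (by omega)) 2
    have h2 : ((n : ℝ) / ((n : ℝ) + 1)) ^ 2 * ((n : ℝ) / 3) ≤ d n ^ 2 * potential d n :=
      mul_le_mul h1 ih' (by positivity) (by positivity)
    have h3 : ((n : ℝ) + 1) / 3 ≤ ((n : ℝ) / ((n : ℝ) + 1)) ^ 2 * ((n : ℝ) / 3) + 1 := by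
      have h4 : ((n : ℝ) / ((n : ℝ) + 1)) ^ 2 * ((n : ℝ) / 3) + 1 - ((n : ℝ) + 1) / 3
          = (3 * n + 2) / (3 * ((n : ℝ) + 1) ^ 2) := by field_simp; ring
      have h5 : 0 ≤ (3 * (n : ℝ) + 2) / (3 * ((n : ℝ) + 1) ^ 2) := by positivity
      linarith
    simp only [potential]; push_cast; linarith

/-- Summed over the steps, this bounds `√(V T) + ∑ (1 - d t) * √(V t)` by `8 / 3 * √T`. Strong
discounting makes the differences large because it keeps `V` small, but no smaller than `t / 3`. -/
theorem sqrt_potential_succ_sub_le {d : ℕ → ℝ} {T : ℕ}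
    (hd : ∀ t < T, (t : ℝ) / ((t : ℝ) + 1) ≤ d t) (n : ℕ) (hn : n < T) :
    √(potential d (n + 1)) - d n * √(potential d n) ≤
      8 / 3 * √((n + 1 : ℕ) : ℝ) - 8 / 3 * √(n : ℝ) := by
  set u := √(potential d (n + 1)) with hu
  set w := d n * √(potential d n) with hw
  set a := √((n + 1 : ℕ) : ℝ) with ha
  set b := √(n : ℝ) with hb
  have hV0 : 0 ≤ potential d n :=
    le_trans (by positivity) (div_three_le_potential hd n hn.le)
  have hV1 := div_three_le_potential hd (n + 1) hn
  have hdn : 0 ≤ d n := le_trans (by positivity) (hd n hn)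
  have ha2 : a ^ 2 = n + 1 := by rw [ha, Real.sq_sqrt (by positivity)]; push_cast; ring
  have hb2 : b ^ 2 = n := Real.sq_sqrt (by positivity)
  have ha0 : 0 ≤ a := Real.sqrt_nonneg _
  have hb0 : 0 ≤ b := Real.sqrt_nonneg _
  have hu0 : 0 ≤ u := Real.sqrt_nonneg _
  have hw0 : 0 ≤ w := mul_nonneg hdn (Real.sqrt_nonneg _)
  have hu2 : u ^ 2 = w ^ 2 + 1 := by
    rw [hu, hw, mul_pow, Real.sq_sqrt hV0, Real.sq_sqrt (le_trans (by positivity) hV1)]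
    simp [potential]
  have hua : 1 / 2 * a ≤ u := by
    apply Real.le_sqrt_of_sq_le
    rw [mul_pow, ha2]; push_cast at hV1; nlinarith [(Nat.cast_nonneg n : (0 : ℝ) ≤ n)]
  have hwb : 1 / 4 * b ≤ w := by
    rcases Nat.eq_zero_or_pos n with h0 | h0
    · have : b = 0 := by rw [hb, h0]; simp
      rw [this]; linarith
    · have hn1 : (1 : ℝ) ≤ n := by exact_mod_cast h0
      have h1 : (1 / 2 : ℝ) ≤ d n := le_trans (by rw [div_le_div_iff₀] <;> linarith) (hd n hn)
      have h2 : 1 / 2 * b ≤ √(potential d n) := by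
        apply Real.le_sqrt_of_sq_le
        rw [mul_pow, hb2]
        have := div_three_le_potential hd n hn.le
        linarith
      have := mul_le_mul h1 h2 (by positivity) hdn
      linarith
  have hba : b ≤ a := Real.sqrt_le_sqrt (by push_cast; linarith)
  have hapos : 0 < a := by rw [ha]; positivity
  -- both differences are reciprocals of sums: `(u - w) (u + w) = 1 = (a - b) (a + b)`
  have hs : 3 / 8 * (a + b) ≤ u + w := by linarith
  have hab : (a - b) * (a + b) = 1 := by nlinarith
  have huw : (u - w) * (u + w) = 1 := by nlinarith
  have h1 : 0 ≤ u - w := by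
    by_contra h
    have : (u - w) * (u + w) ≤ 0 := mul_nonpos_of_nonpos_of_nonneg (by linarith) (by linarith)
    linarith
  have h2 : (u - w) * (3 / 8 * (a + b)) ≤ 1 := huw ▸ mul_le_mul_of_nonneg_left hs h1
  have h3 : (u - w) * (a + b) ≤ (8 / 3 * a - 8 / 3 * b) * (a + b) := by nlinarith
  exact le_of_mul_le_mul_right h3 (by linarith)

end Potential

/-! ### Regret matching with discounting -/

section RegretMatching

variable {A : Type*} {S : Finset A} {D : ℝ} {T : ℕ} {dp dm g : ℕ → ℝ} {R r : ℕ → A → ℝ}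

/-- Blackwell's potential argument: as the played strategy is orthogonal to the instantaneous
regrets, the squared positive regrets grow by at most `D ^ 2` per action and step. -/
theorem sum_sq_pos_le (hR0 : ∀ a, R 0 a = 0)
    (hR : ∀ t a, R (t + 1) a = R t a * (if 0 < R t a then dp t else dm t) + r t a)
    (hr : ∀ t < T, ∀ a ∈ S, |r t a| ≤ D)
    (horth : ∀ t < T, ∑ a ∈ S, max (R t a) 0 * r t a = 0)
    (hdm0 : ∀ t < T, 0 ≤ dm t) (n : ℕ) (hn : n ≤ T) :
    ∑ a ∈ S, max (R n a) 0 ^ 2 ≤ D ^ 2 * S.card * potential dp n := by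
  induction n with
  | zero => simp [hR0, potential]
  | succ n ih =>
    have ih' := ih (by omega)
    have key : ∀ a ∈ S, max (R (n + 1) a) 0 ^ 2 ≤
        dp n ^ 2 * max (R n a) 0 ^ 2 + 2 * dp n * (max (R n a) 0 * r n a) + D ^ 2 := by
      intro a ha
      have h1 : r n a ^ 2 ≤ D ^ 2 := sq_le_sq.2 ((hr n hn a ha).trans (le_abs_self D))
      have h2 : max (R (n + 1) a) 0 ^ 2 ≤ (dp n * max (R n a) 0 + r n a) ^ 2 := by
        rw [hR]
        split_ifs with h
        · rw [max_eq_left h.le]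
          have : R n a * dp n + r n a = dp n * R n a + r n a := by ring
          rw [this, sq_le_sq]
          rcases le_total (dp n * R n a + r n a) 0 with h3 | h3
          · rw [max_eq_right h3]; simp
          · rw [max_eq_left h3]
        · rw [max_eq_right (not_lt.1 h)]
          have h3 : R n a * dm n ≤ 0 :=
            mul_nonpos_of_nonpos_of_nonneg (not_lt.1 h) (hdm0 n hn)
          rw [mul_zero, zero_add, sq_le_sq]
          rw [abs_of_nonneg (le_max_right _ _)]
          exact max_le (by linarith [le_abs_self (r n a)]) (abs_nonneg _)
      nlinarith
    calc ∑ a ∈ S, max (R (n + 1) a) 0 ^ 2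
        ≤ ∑ a ∈ S, (dp n ^ 2 * max (R n a) 0 ^ 2 + 2 * dp n * (max (R n a) 0 * r n a) + D ^ 2) :=
          Finset.sum_le_sum key
      _ = dp n ^ 2 * ∑ a ∈ S, max (R n a) 0 ^ 2 + D ^ 2 * S.card := by
          rw [Finset.sum_add_distrib, Finset.sum_add_distrib, ← Finset.mul_sum, ← Finset.mul_sum,
            horth n hn, Finset.sum_const, nsmul_eq_mul]
          ring
      _ ≤ dp n ^ 2 * (D ^ 2 * S.card * potential dp n) + D ^ 2 * S.card := by gcongr
      _ = D ^ 2 * S.card * potential dp (n + 1) := by simp only [potential]; ring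

/-- Negative regrets are at least halved before a term of size at most `D` is added. -/
theorem neg_two_mul_le_regret (hR0 : ∀ a, R 0 a = 0)
    (hR : ∀ t a, R (t + 1) a = R t a * (if 0 < R t a then dp t else dm t) + r t a)
    (hD : 0 ≤ D) (hr : ∀ t < T, ∀ a ∈ S, |r t a| ≤ D) (hdp0 : ∀ t < T, 0 ≤ dp t)
    (hdm0 : ∀ t < T, 0 ≤ dm t) (hdm : ∀ t < T, dm t ≤ 1 / 2) {a : A} (ha : a ∈ S)
    (n : ℕ) (hn : n ≤ T) : -(2 * D) ≤ R n a := by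
  induction n with
  | zero => rw [hR0]; linarith
  | succ n ih =>
    have ih' := ih (by omega)
    have h1 := (abs_le.1 (hr n hn a ha)).1
    rw [hR]
    split_ifs with h
    · have := mul_nonneg h.le (hdp0 n hn); linarith
    · have := hdm n hn
      have := hdm0 n hn
      nlinarith

/-- Regret matching with separately discounted positive and negative regrets has small discounted
regret for *every* sequence `g` of averaging discounts in `[0, 1]`. The difference between the
`g`-discounted regret and the regret `R` used by the algorithm changes on each step by a multiple of
`R`, and the two signs of `R` are controlled by `sum_sq_pos_le` and `neg_two_mul_le_regret`. -/
theorem discSum_regret_le (hR0 : ∀ a, R 0 a = 0)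
    (hR : ∀ t a, R (t + 1) a = R t a * (if 0 < R t a then dp t else dm t) + r t a)
    (hD : 0 ≤ D) (hr : ∀ t < T, ∀ a ∈ S, |r t a| ≤ D)
    (horth : ∀ t < T, ∑ a ∈ S, max (R t a) 0 * r t a = 0)
    (hdp : ∀ t < T, (t : ℝ) / ((t : ℝ) + 1) ≤ dp t) (hdp1 : ∀ t < T, dp t ≤ 1)
    (hdm0 : ∀ t < T, 0 ≤ dm t) (hdm : ∀ t < T, dm t ≤ 1 / 2)
    (hg0 : ∀ t < T, 0 ≤ g t) (hg1 : ∀ t < T, g t ≤ 1) {a : A} (ha : a ∈ S) :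
    discSum g (fun t => r t a) T ≤ D * (8 / 3 * √(S.card : ℝ) * √(T : ℝ) + 2) := by
  set M := D * √(S.card : ℝ) with hM
  have hM0 : 0 ≤ M := by positivity
  have hRle : ∀ n ≤ T, R n a ≤ M * √(potential dp n) := by
    intro n hn
    have hV : 0 ≤ potential dp n := le_trans (by positivity) (div_three_le_potential hdp n hn)
    have h1 : max (R n a) 0 ^ 2 ≤ D ^ 2 * S.card * potential dp n :=
      (Finset.single_le_sum (f := fun a => max (R n a) 0 ^ 2) (fun _ _ => sq_nonneg _) ha).trans
        (sum_sq_pos_le hR0 hR hr horth hdm0 n hn)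
    have h2 : (M * √(potential dp n)) ^ 2 = D ^ 2 * S.card * potential dp n := by
      rw [hM, mul_pow, mul_pow, Real.sq_sqrt (by positivity), Real.sq_sqrt hV]
    rw [← h2] at h1
    exact (le_max_left _ _).trans (le_of_sq_le_sq h1 (by positivity))
  have hc : ∀ n ≤ T, 0 ≤ 8 / 3 * √(n : ℝ) - √(potential dp n) ∧
      discSum g (fun t => r t a) n - R n a ≤
        M * (8 / 3 * √(n : ℝ) - √(potential dp n)) + 2 * D := by
    intro n
    induction n with
    | zero => intro _; simp [discSum, hR0, potential, hD]
    | succ n ih =>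
      intro hn
      obtain ⟨ih0, ih1⟩ := ih (by omega)
      have hstep := sqrt_potential_succ_sub_le hdp n hn
      have hV := Real.sqrt_nonneg (potential dp n)
      have hg0' := hg0 n hn
      have hg1' := hg1 n hn
      have hd1 : 0 ≤ (1 - dp n) * √(potential dp n) := mul_nonneg (by linarith [hdp1 n hn]) hV
      refine ⟨by linarith, ?_⟩
      have hMstep := mul_le_mul_of_nonneg_left hstep hM0
      set c := 8 / 3 * √(n : ℝ) - √(potential dp n) with hcdef
      have hMc : 0 ≤ M * c := mul_nonneg hM0 ih0
      have h1 := mul_le_mul_of_nonneg_right ih1 hg0'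
      have h2 : (M * c + 2 * D) * g n ≤ M * c + 2 * D * g n := by nlinarith
      have h3 : M * c + M * ((1 - dp n) * √(potential dp n)) ≤
          M * (8 / 3 * √((n + 1 : ℕ) : ℝ) - √(potential dp (n + 1))) := by
        rw [← mul_add]; exact mul_le_mul_of_nonneg_left (by rw [hcdef]; linarith) hM0
      have hMd := mul_nonneg hM0 hd1
      simp only [discSum]
      rw [hR]
      split_ifs with h
      · have h4 := hRle n (by omega)
        have h5 : (g n - dp n) * R n a ≤ (1 - dp n) * (M * √(potential dp n)) :=
          (mul_le_mul_of_nonneg_right (by linarith) h.le).trans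
            (mul_le_mul_of_nonneg_left h4 (by linarith [hdp1 n hn]))
        have h6 : 2 * D * g n ≤ 2 * D := by nlinarith
        linarith
      · have h4 := neg_two_mul_le_regret hR0 hR hD hr
          (fun t ht => le_trans (by positivity) (hdp t ht)) hdm0 hdm ha n (by omega)
        have h5 := hdm n hn
        have h6 : (g n - dm n) * R n a ≤ 2 * D * (1 - g n) := by
          rcases le_total (dm n) (g n) with h7 | h7
          · have : (g n - dm n) * R n a ≤ 0 :=
              mul_nonpos_of_nonneg_of_nonpos (by linarith) (not_lt.1 h)
            have : 0 ≤ 2 * D * (1 - g n) := mul_nonneg (by linarith) (by linarith)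
            linarith
          · have h8 : (dm n - g n) * (-R n a) ≤ (1 - g n) * (2 * D) :=
              mul_le_mul (by linarith) (by linarith) (by linarith [not_lt.1 h]) (by linarith)
            linarith
        linarith
  have h1 := (hc T le_rfl).2
  have h2 := hRle T le_rfl
  have h3 : D * (8 / 3 * √(S.card : ℝ) * √(T : ℝ) + 2) = M * (8 / 3 * √(T : ℝ)) + 2 * D := by
    rw [hM]; ring
  rw [h3]; linarith

end RegretMatching

/-! ### Game trees -/

namespace GameTree

variable {A : Type*} [Fintype A] [DecidableEq A] {G : GameTree A}

theorem mem_actions {h : List A} {a : A} : a ∈ G.actions h ↔ h ++ [a] ∈ G.hist := by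
  simp [actions]

theorem mem_hist_of_append {h l : List A} (H : h ++ l ∈ G.hist) : h ∈ G.hist := by
  induction l using List.reverseRecOn with
  | nil => simpa using H
  | append_singleton l a ih =>
    rw [← List.append_assoc] at H
    exact ih (G.prefix_closed _ _ H)

/-- Induction on histories from the leaves of the tree to its root. -/
theorem hist_induction {P : List A → Prop}
    (step : ∀ h ∈ G.hist, (∀ a ∈ G.actions h, P (h ++ [a])) → P h) :
    ∀ h ∈ G.hist, P h := by
  obtain ⟨N, hN⟩ : ∃ N, ∀ h ∈ G.hist, h.length ≤ N :=
    ⟨G.hist.sup List.length, fun h hh => Finset.le_sup (f := List.length) hh⟩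
  suffices H : ∀ n, ∀ h ∈ G.hist, N - h.length ≤ n → P h from
    fun h hh => H _ h hh le_rfl
  intro n
  induction n with
  | zero =>
    intro h hh hn
    refine step h hh fun a ha => ?_
    have := hN _ (mem_actions.1 ha)
    simp at this; omega
  | succ n ih =>
    intro h hh hn
    refine step h hh fun a ha => ih _ (mem_actions.1 ha) ?_
    have := hN _ (mem_actions.1 ha)
    simp at this ⊢; omega

/-- Every history is either empty or the child of exactly one history. -/
theorem sum_hist_eq (F : List A → ℝ) :
    ∑ h ∈ G.hist, F h = F [] + ∑ h ∈ G.hist, ∑ a ∈ G.actions h, F (h ++ [a]) := by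
  rw [← Finset.add_sum_erase _ _ G.nil_mem, Finset.sum_sigma']
  congr 1
  symm
  refine Finset.sum_bij (fun p _ => p.1 ++ [p.2]) ?_ ?_ ?_ ?_
  · rintro ⟨h, a⟩ hp
    simp only [Finset.mem_sigma, mem_actions] at hp
    simpa using hp.2
  · rintro ⟨h, a⟩ _ ⟨h', a'⟩ _ heq
    obtain ⟨rfl, h2⟩ := List.append_inj' heq rfl
    simp at h2
    subst h2; rfl
  · intro z hz
    obtain ⟨hz0, hz1⟩ := Finset.mem_erase.1 hz
    rcases List.eq_nil_or_concat z with rfl | ⟨l, a, rfl⟩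
    · exact absurd rfl hz0
    · simp only [List.concat_eq_append] at hz1 ⊢
      exact ⟨⟨l, a⟩, Finset.mem_sigma.2 ⟨G.prefix_closed _ _ hz1, mem_actions.2 hz1⟩, rfl⟩
  · intros; rfl

/-- A nonnegative weight that never increases in total from a history to its children gives an
antichain of histories at most the weight of the root. -/
theorem sum_antichain_le {w : List A → ℝ} (hw0 : ∀ h ∈ G.hist, 0 ≤ w h)
    (hw : ∀ h ∈ G.hist, ∑ a ∈ G.actions h, w (h ++ [a]) ≤ w h)
    {S : Finset (List A)} (hS : S ⊆ G.hist)
    (hanti : ∀ h ∈ S, ∀ h' ∈ S, h <+: h' → h = h') :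
    ∑ h ∈ S, w h ≤ w [] := by
  have key : ∀ g ∈ G.hist, ∑ h ∈ S.filter (fun h => g <+: h), w h ≤ w g := by
    refine hist_induction fun g hg ih => ?_
    by_cases hgS : g ∈ S
    · have : S.filter (fun h => g <+: h) = {g} := by
        ext h
        simp only [Finset.mem_filter, Finset.mem_singleton]
        constructor
        · rintro ⟨h1, h2⟩; exact (hanti g hgS h h1 h2).symm
        · rintro rfl; exact ⟨hgS, List.prefix_rfl⟩
      rw [this]; simp
    · have hsub : S.filter (fun h => g <+: h) ⊆
          (G.actions g).biUnion fun a => S.filter (fun h => g ++ [a] <+: h) := by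
        intro h hh
        obtain ⟨h1, l, rfl⟩ := Finset.mem_filter.1 hh
        cases l with
        | nil => simp at h1; exact absurd h1 hgS
        | cons a l =>
          have h2 : g ++ [a] <+: g ++ a :: l := ⟨l, by simp⟩
          refine Finset.mem_biUnion.2 ⟨a, mem_actions.2 ?_, Finset.mem_filter.2 ⟨h1, h2⟩⟩
          exact mem_hist_of_append (l := l) (by simpa using hS h1)
      calc ∑ h ∈ S.filter (fun h => g <+: h), w h
          ≤ ∑ h ∈ (G.actions g).biUnion fun a => S.filter (fun h => g ++ [a] <+: h), w h := by
            refine Finset.sum_le_sum_of_subset_of_nonneg hsub fun h hh _ => ?_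
            obtain ⟨a, _, h2⟩ := Finset.mem_biUnion.1 hh
            exact hw0 h (hS (Finset.mem_filter.1 h2).1)
        _ = ∑ a ∈ G.actions g, ∑ h ∈ S.filter (fun h => g ++ [a] <+: h), w h := by
            refine Finset.sum_biUnion fun a _ b _ hab => ?_
            refine Finset.disjoint_left.2 fun h h1 h2 => hab ?_
            have h3 := (Finset.mem_filter.1 h1).2
            have h4 := (Finset.mem_filter.1 h2).2
            have h5 := (List.prefix_of_prefix_length_le h3 h4 (by simp)).eq_of_length (by simp)
            simpa using h5
        _ ≤ ∑ a ∈ G.actions g, w (g ++ [a]) := Finset.sum_le_sum fun a ha => ih a ha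
        _ ≤ w g := hw g hg
  have := key [] G.nil_mem
  simpa using this

end GameTree

namespace ZeroSumGame

/-! ### Reach probabilities -/

section PathProd

variable {A : Type*}

theorem pathProd_append (f : List A → A → ℝ) (g l l' : List A) :
    pathProd f g (l ++ l') = pathProd f g l * pathProd f (g ++ l) l' := by
  induction l generalizing g with
  | nil => simp [pathProd]
  | cons a l ih => simp [pathProd, ih, mul_assoc]

theorem pathProd_concat (f : List A → A → ℝ) (h : List A) (a : A) :
    pathProd f [] (h ++ [a]) = pathProd f [] h * f h a := by
  simp [pathProd_append, pathProd]

theorem pathProd_mul (f₁ f₂ : List A → A → ℝ) (g l : List A) :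
    pathProd (fun h a => f₁ h a * f₂ h a) g l = pathProd f₁ g l * pathProd f₂ g l := by
  induction l generalizing g with
  | nil => simp [pathProd]
  | cons a l ih => simp only [pathProd, ih]; ring

end PathProd

variable {A K : Type*} [Fintype A] [DecidableEq A] [DecidableEq K] {G : ZeroSumGame A K}
  {σ τ : Fin 2 → K → A → ℝ} {i j : Fin 2} {I : K} {h : List A} {a : A}

section InfoSets

theorem mem_decisionNodes :
    h ∈ G.decisionNodes i ↔ h ∈ G.hist ∧ (G.actions h).Nonempty ∧ G.turn h = some i := by
  simp [decisionNodes]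

theorem mem_members : h ∈ G.members i I ↔ h ∈ G.decisionNodes i ∧ G.info h = I := by
  simp [members]

theorem mem_decisionNodes_of_mem_actions (hh : h ∈ G.hist) (ht : G.turn h = some i)
    (ha : a ∈ G.actions h) : h ∈ G.decisionNodes i :=
  mem_decisionNodes.2 ⟨hh, ⟨a, ha⟩, ht⟩

theorem info_mem_infoSets (hh : h ∈ G.decisionNodes i) : G.info h ∈ G.infoSets i :=
  Finset.mem_image_of_mem _ hh

theorem members_nonempty (hI : I ∈ G.infoSets i) : (G.members i I).Nonempty := by
  obtain ⟨h, hh, rfl⟩ := Finset.mem_image.1 hI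
  exact ⟨h, mem_members.2 ⟨hh, rfl⟩⟩

theorem infoActions_eq (hh : h ∈ G.members i I) : G.infoActions i I = G.actions h := by
  ext a
  simp only [infoActions, Finset.mem_biUnion]
  refine ⟨?_, fun ha => ⟨h, hh, ha⟩⟩
  rintro ⟨h', hh', ha⟩
  obtain ⟨h1, h2⟩ := mem_members.1 hh
  obtain ⟨h1', h2'⟩ := mem_members.1 hh'
  obtain ⟨m, n, t⟩ := mem_decisionNodes.1 h1
  obtain ⟨m', n', t'⟩ := mem_decisionNodes.1 h1'
  rwa [G.info_actions h m h' m' n n' (by simp [t]) (by rw [t, t']) (by rw [h2, h2'])]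

theorem infoActions_info (hh : h ∈ G.decisionNodes i) :
    G.infoActions i (G.info h) = G.actions h :=
  infoActions_eq (mem_members.2 ⟨hh, rfl⟩)

theorem infoActions_nonempty (hI : I ∈ G.infoSets i) : (G.infoActions i I).Nonempty := by
  obtain ⟨h, hh⟩ := members_nonempty hI
  rw [infoActions_eq hh]
  exact (mem_decisionNodes.1 (mem_members.1 hh).1).2.1

theorem card_infoActions_le_maxActions (hI : I ∈ G.infoSets i) :
    (G.infoActions i I).card ≤ G.maxActions :=
  (Finset.le_sup (f := fun I => (G.infoActions i I).card) hI).trans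
    (Finset.le_sup (f := fun i => (G.infoSets i).sup fun I => (G.infoActions i I).card)
      (Finset.mem_univ i))

end InfoSets

section Reach

theorem actProb_of_turn (ht : G.turn h = some i) : G.actProb σ h a = σ i (G.info h) a := by
  simp [actProb, ht]

theorem ownProb_of_turn (ht : G.turn h = some i) : G.ownProb σ i h a = σ i (G.info h) a := by
  simp [ownProb, actProb, ht]

theorem ownProb_of_turn_ne (ht : G.turn h ≠ some i) : G.ownProb σ i h a = 1 := by
  simp [ownProb, ht]

theorem ownProb_congr (hσ : σ i = τ i) : G.ownProb σ i = G.ownProb τ i := by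
  funext h a
  by_cases ht : G.turn h = some i
  · rw [ownProb_of_turn ht, ownProb_of_turn ht, hσ]
  · rw [ownProb_of_turn_ne ht, ownProb_of_turn_ne ht]

theorem ownReach_congr (hσ : σ i = τ i) : G.ownReach σ i h = G.ownReach τ i h := by
  rw [ownReach, ownReach, ownProb_congr hσ]

theorem actProb_update_of_turn_ne (s : K → A → ℝ) (ht : G.turn h ≠ some i) :
    G.actProb (Function.update σ i s) h a = G.actProb σ h a := by
  unfold actProb
  split
  · rfl
  · rename_i j hj
    rw [Function.update_of_ne]
    rintro rfl; exact ht hj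

theorem otherReach_update (s : K → A → ℝ) :
    G.otherReach (Function.update σ i s) i h = G.otherReach σ i h := by
  unfold otherReach
  congr 1
  funext h a
  unfold otherProb
  split_ifs with ht
  · rfl
  · exact actProb_update_of_turn_ne s ht

theorem reach_eq_own_mul_other (i : Fin 2) :
    G.reach σ h = G.ownReach σ i h * G.otherReach σ i h := by
  rw [reach, ownReach, otherReach, ← pathProd_mul]
  congr 1
  funext h a
  unfold ownProb otherProb
  split_ifs <;> simp

/-- The contribution of chance to the probability of reaching a history. -/
noncomputable def chanceReach (G : ZeroSumGame A K) (h : List A) : ℝ :=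
  pathProd (fun h a => if G.turn h = none then G.chance h a else 1) [] h

theorem reach_eq_own_mul_own (i : Fin 2) :
    G.reach σ h = G.ownReach σ i h * (G.ownReach σ i.rev h * G.chanceReach h) := by
  rw [reach, ownReach, ownReach, chanceReach, ← pathProd_mul, ← pathProd_mul]
  congr 1
  funext h a
  unfold ownProb actProb
  rcases G.turn h with _ | j
  · simp
  · fin_cases i <;> fin_cases j <;> simp [Fin.rev]

theorem actProb_nonneg (hσ : G.IsProfile σ) (hh : h ∈ G.hist) (ha : a ∈ G.actions h) :
    0 ≤ G.actProb σ h a := by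
  rcases ht : G.turn h with _ | j
  · simpa [actProb, ht] using G.chance_nonneg h hh ht a ha
  · rw [actProb_of_turn ht]
    have hd := mem_decisionNodes_of_mem_actions hh ht ha
    exact (hσ j _ (info_mem_infoSets hd)).1 a (by rwa [infoActions_info hd])

theorem sum_actProb (hσ : G.IsProfile σ) (hh : h ∈ G.hist) (hne : (G.actions h).Nonempty) :
    ∑ a ∈ G.actions h, G.actProb σ h a = 1 := by
  rcases ht : G.turn h with _ | j
  · simpa [actProb, ht] using G.chance_sum h hh ht hne
  · simp only [actProb_of_turn ht]
    have hd := mem_decisionNodes.2 ⟨hh, hne, ht⟩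
    rw [← infoActions_info hd]
    exact (hσ j _ (info_mem_infoSets hd)).2

theorem pathProd_nonneg {f : List A → A → ℝ}
    (hf : ∀ h ∈ G.hist, ∀ a ∈ G.actions h, 0 ≤ f h a) (hh : h ∈ G.hist) :
    0 ≤ pathProd f [] h := by
  induction h using List.reverseRecOn with
  | nil => simp [pathProd]
  | append_singleton l a ih =>
    rw [pathProd_concat]
    have hl := G.prefix_closed _ _ hh
    exact mul_nonneg (ih hl) (hf l hl a (GameTree.mem_actions.2 hh))

theorem ownProb_mem_Icc (hσ : G.IsStrategy i (σ i)) (hh : h ∈ G.hist) (ha : a ∈ G.actions h) :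
    G.ownProb σ i h a ∈ Set.Icc (0 : ℝ) 1 := by
  by_cases ht : G.turn h = some i
  · rw [ownProb_of_turn ht]
    have hd := mem_decisionNodes_of_mem_actions hh ht ha
    have hs := hσ _ (info_mem_infoSets hd)
    rw [infoActions_info hd] at hs
    exact ⟨hs.1 a ha, hs.2 ▸ Finset.single_le_sum (f := fun b => σ i (G.info h) b) hs.1 ha⟩
  · rw [ownProb_of_turn_ne ht]; simp

theorem ownReach_nonneg (hσ : G.IsStrategy i (σ i)) (hh : h ∈ G.hist) :
    0 ≤ G.ownReach σ i h :=
  pathProd_nonneg (fun _ h1 _ h2 => (ownProb_mem_Icc hσ h1 h2).1) hh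

theorem ownReach_le_one (hσ : G.IsStrategy i (σ i)) (hh : h ∈ G.hist) :
    G.ownReach σ i h ≤ 1 := by
  induction h using List.reverseRecOn with
  | nil => simp [ownReach, pathProd]
  | append_singleton l a ih =>
    have hl := G.prefix_closed _ _ hh
    have h1 := ownProb_mem_Icc hσ hl (GameTree.mem_actions.2 hh)
    rw [ownReach, pathProd_concat]
    exact mul_le_one₀ (ih hl) h1.1 h1.2

theorem otherProb_nonneg (hσ : G.IsProfile σ) (hh : h ∈ G.hist) (ha : a ∈ G.actions h) :
    0 ≤ G.otherProb σ i h a := by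
  unfold otherProb
  split_ifs
  · exact zero_le_one
  · exact actProb_nonneg hσ hh ha

theorem otherReach_nonneg (hσ : G.IsProfile σ) (hh : h ∈ G.hist) : 0 ≤ G.otherReach σ i h :=
  pathProd_nonneg (fun _ h1 _ h2 => otherProb_nonneg hσ h1 h2) hh

end Reach

/-! ### Perfect recall -/

section Recall

theorem ownSequence_append (g l l' : List A) :
    G.ownSequence i g (l ++ l') = G.ownSequence i g l ++ G.ownSequence i (g ++ l) l' := by
  induction l generalizing g with
  | nil => simp [ownSequence]
  | cons a l ih =>
    simp only [List.cons_append, ownSequence, ih]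
    split_ifs <;> simp

theorem ownSequence_concat (h : List A) (a : A) :
    G.ownSequence i [] (h ++ [a]) =
      G.ownSequence i [] h ++ if G.turn h = some i then [(G.info h, a)] else [] := by
  rw [ownSequence_append]
  simp [ownSequence]

/-- The contribution of a player to the reach probability depends only on what that player has
observed and done. -/
theorem ownReach_eq_prod (h : List A) :
    G.ownReach σ i h = ((G.ownSequence i [] h).map fun p => σ i p.1 p.2).prod := by
  induction h using List.reverseRecOn with
  | nil => simp [ownReach, pathProd, ownSequence]
  | append_singleton l a ih =>
    rw [ownReach, pathProd_concat, ← ownReach, ih, ownSequence_concat]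
    split_ifs with ht
    · simp [ownProb_of_turn ht]
    · simp [ownProb_of_turn_ne ht]

theorem PerfectRecall.ownReach_eq (hG : G.PerfectRecall) {h h' : List A}
    (hh : h ∈ G.members i I) (hh' : h' ∈ G.members i I) :
    G.ownReach σ i h = G.ownReach σ i h' := by
  obtain ⟨h1, h2⟩ := mem_members.1 hh
  obtain ⟨h1', h2'⟩ := mem_members.1 hh'
  rw [ownReach_eq_prod, ownReach_eq_prod, hG i h h1 h' h1' (h2.trans h2'.symm)]

theorem PerfectRecall.ownInfoReach_eq (hG : G.PerfectRecall) (hh : h ∈ G.members i I) :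
    G.ownInfoReach σ i I = (G.members i I).card * G.ownReach σ i h := by
  rw [ownInfoReach, Finset.sum_congr rfl fun h' hh' => hG.ownReach_eq hh' hh]
  simp

theorem PerfectRecall.members_antichain (hG : G.PerfectRecall) {h h' : List A}
    (hh : h ∈ G.members i I) (hh' : h' ∈ G.members i I) (hp : h <+: h') : h = h' := by
  obtain ⟨l, rfl⟩ := hp
  cases l with
  | nil => simp
  | cons a l =>
    obtain ⟨h1, h2⟩ := mem_members.1 hh
    obtain ⟨h1', h2'⟩ := mem_members.1 hh'
    have heq := hG i _ h1 _ h1' (h2.trans h2'.symm)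
    have hlen := congrArg List.length heq
    rw [ownSequence_append] at hlen
    simp [ownSequence, (mem_decisionNodes.1 h1).2.2] at hlen

/-- The opponent and chance reach an information set with total probability at most `1`. The
histories that are consistent with the past of player `i` at that information set carry, weighted
by `otherReach`, a subprobability flow, in which the information set is an antichain. -/
theorem PerfectRecall.sum_otherReach_le_one (hG : G.PerfectRecall) (hσ : G.IsProfile σ)
    (i : Fin 2) (I : K) : ∑ h ∈ G.members i I, G.otherReach σ i h ≤ 1 := by
  rcases (G.members i I).eq_empty_or_nonempty with hE | ⟨h₀, hh₀⟩
  · simp [hE]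
  classical
  set q := G.ownSequence i [] h₀ with hq
  set w : List A → ℝ := fun h =>
    if G.ownSequence i [] h <+: q then G.otherReach σ i h else 0 with hw
  have hsum : ∑ h ∈ G.members i I, G.otherReach σ i h = ∑ h ∈ G.members i I, w h := by
    refine Finset.sum_congr rfl fun h hh => ?_
    obtain ⟨h1, h2⟩ := mem_members.1 hh
    obtain ⟨h1', h2'⟩ := mem_members.1 hh₀
    rw [hw]
    simp only
    rw [if_pos]
    rw [hq, hG i h h1 h₀ h1' (h2.trans h2'.symm)]
  rw [hsum]
  have hroot : w [] = 1 := by simp [hw, ownSequence, otherReach, pathProd]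
  rw [← hroot]
  refine GameTree.sum_antichain_le (G := G.toGameTree) ?_ ?_ ?_ ?_
  · intro h hh
    simp only [hw]
    split_ifs
    · exact otherReach_nonneg hσ hh
    · exact le_rfl
  · intro h hh
    by_cases hpre : G.ownSequence i [] h <+: q
    swap
    · have : ∀ a ∈ G.actions h, w (h ++ [a]) = 0 := by
        intro a _
        simp only [hw]
        rw [if_neg]
        rw [ownSequence_append]
        exact fun hc => hpre ((List.prefix_append _ _).trans hc)
      rw [Finset.sum_congr rfl this]
      simp [hw, hpre]
    have hwh : w h = G.otherReach σ i h := by simp [hw, hpre]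
    rw [hwh]
    have h0 := otherReach_nonneg (i := i) hσ hh
    by_cases ht : G.turn h = some i
    · -- at most one action continues the prescribed past
      have hval : ∀ a, w (h ++ [a]) =
          if G.ownSequence i [] h ++ [(G.info h, a)] <+: q then G.otherReach σ i h else 0 := by
        intro a
        simp only [hw, ownSequence_concat, if_pos ht]
        rw [otherReach, pathProd_concat, ← otherReach]
        simp [otherProb, ht]
      simp only [hval]
      rw [← Finset.sum_filter, Finset.sum_const, nsmul_eq_mul]
      have hcard : ((G.actions h).filter fun a =>
          G.ownSequence i [] h ++ [(G.info h, a)] <+: q).card ≤ 1 := by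
        refine Finset.card_le_one.2 fun a ha b hb => ?_
        have h3 := (Finset.mem_filter.1 ha).2
        have h4 := (Finset.mem_filter.1 hb).2
        have h5 := (List.prefix_of_prefix_length_le h3 h4 (by simp)).eq_of_length (by simp)
        simpa using h5
      have hcard' : ((((G.actions h).filter fun a =>
          G.ownSequence i [] h ++ [(G.info h, a)] <+: q).card : ℕ) : ℝ) ≤ 1 := by
        exact_mod_cast hcard
      nlinarith
    · have hval : ∀ a, w (h ++ [a]) = G.otherReach σ i h * G.actProb σ h a := by
        intro a
        simp only [hw, ownSequence_concat, if_neg ht, List.append_nil, if_pos hpre]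
        rw [otherReach, pathProd_concat, ← otherReach]
        simp [otherProb, ht]
      simp only [hval]
      rw [← Finset.mul_sum]
      rcases (G.actions h).eq_empty_or_nonempty with hE | hne
      · simpa [hE] using h0
      · rw [sum_actProb hσ hh hne, mul_one]
  · exact fun h hh => (mem_decisionNodes.1 (mem_members.1 hh).1).1
  · exact fun h hh h' hh' => hG.members_antichain hh hh'

end Recall

/-! ### Values of histories and one-step gains -/

section Value

/-- The expected utility of player `i` when play starts at the history `h`. -/
noncomputable def nodeValue (G : ZeroSumGame A K) (σ : Fin 2 → K → A → ℝ) (i : Fin 2)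
    (h : List A) : ℝ :=
  ∑ z ∈ G.terminal, G.intervalReach σ h z * G.utility i z

theorem nodeValue_nil : G.nodeValue σ i [] = G.expUtility i σ := by
  simp [nodeValue, expUtility, intervalReach, reach]

theorem nodeValue_terminal (hh : h ∈ G.terminal) : G.nodeValue σ i h = G.utility i h := by
  rw [nodeValue, Finset.sum_eq_single_of_mem h hh]
  · simp [intervalReach, pathProd]
  · intro z hz hne
    rw [intervalReach, if_neg, zero_mul]
    rintro ⟨l, rfl⟩
    cases l with
    | nil => simp at hne
    | cons a l =>
      have h1 : h ++ [a] ∈ G.hist :=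
        GameTree.mem_hist_of_append (l := l) (by simpa using (Finset.mem_filter.1 hz).1)
      have h2 := GameTree.mem_actions.2 h1
      rw [(Finset.mem_filter.1 hh).2] at h2
      simp at h2

theorem nodeValue_step (hne : (G.actions h).Nonempty) :
    G.nodeValue σ i h = ∑ a ∈ G.actions h, G.actProb σ h a * G.nodeValue σ i (h ++ [a]) := by
  simp only [nodeValue, Finset.mul_sum]
  rw [Finset.sum_comm]
  refine Finset.sum_congr rfl fun z hz => ?_
  simp only [← mul_assoc]
  rw [← Finset.sum_mul]
  congr 1
  obtain ⟨hzh, hzt⟩ := Finset.mem_filter.1 hz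
  by_cases hp : h <+: z
  · obtain ⟨l, rfl⟩ := hp
    cases l with
    | nil => rw [List.append_nil] at hzt; exact absurd hzt hne.ne_empty
    | cons b l =>
      have h1 : h ++ [b] ∈ G.hist := GameTree.mem_hist_of_append (l := l) (by simpa using hzh)
      rw [Finset.sum_eq_single_of_mem b (GameTree.mem_actions.2 h1)]
      · have h2 : h ++ [b] <+: h ++ b :: l := ⟨l, by simp⟩
        rw [intervalReach, intervalReach, if_pos (List.prefix_append _ _), if_pos h2]
        have h3 : h ++ b :: l = (h ++ [b]) ++ l := by simp
        rw [List.drop_left, h3, List.drop_left, pathProd]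
      · intro a _ hab
        rw [intervalReach, if_neg, mul_zero]
        rintro ⟨l', h3⟩
        rw [List.append_assoc] at h3
        have h4 := List.append_cancel_left h3
        simp at h4
        exact hab h4.1
  · rw [intervalReach, if_neg hp, Finset.sum_eq_zero]
    intro a _
    rw [intervalReach, if_neg, mul_zero]
    exact fun h1 => hp ((List.prefix_append _ _).trans h1)

theorem nodeValue_mem_Icc (hσ : G.IsProfile σ) (i : Fin 2) :
    ∀ h ∈ G.hist, G.nodeValue σ i h ∈ Set.Icc (G.terminal.inf' G.terminal_nonempty (G.utility i))
      (G.terminal.sup' G.terminal_nonempty (G.utility i)) := by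
  refine GameTree.hist_induction fun h hh ih => ?_
  rcases (G.actions h).eq_empty_or_nonempty with hE | hne
  · have hz : h ∈ G.terminal := Finset.mem_filter.2 ⟨hh, hE⟩
    rw [nodeValue_terminal hz]
    exact ⟨Finset.inf'_le _ hz, Finset.le_sup' _ hz⟩
  · rw [nodeValue_step hne]
    simpa using (convex_Icc (𝕜 := ℝ) _ _).sum_mem (fun a ha => actProb_nonneg hσ hh ha)
      (sum_actProb hσ hh hne) ih

theorem utilityRange_nonneg (i : Fin 2) : 0 ≤ G.utilityRange i := by
  obtain ⟨z, hz⟩ := G.terminal_nonempty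
  exact sub_nonneg.2 ((Finset.inf'_le _ hz).trans (Finset.le_sup' (G.utility i) hz))

theorem instRegret_eq (i : Fin 2) (I : K) (a : A) : G.instRegret σ i I a =
    ∑ h ∈ G.members i I,
      G.otherReach σ i h * (G.nodeValue σ i (h ++ [a]) - G.nodeValue σ i h) := by
  simp only [mul_sub, Finset.sum_sub_distrib]
  rfl

theorem PerfectRecall.abs_instRegret_le (hG : G.PerfectRecall) (hσ : G.IsProfile σ)
    (ha : a ∈ G.infoActions i I) : |G.instRegret σ i I a| ≤ G.utilityRange i := by
  rw [instRegret_eq]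
  calc |∑ h ∈ G.members i I,
        G.otherReach σ i h * (G.nodeValue σ i (h ++ [a]) - G.nodeValue σ i h)|
      ≤ ∑ h ∈ G.members i I,
        |G.otherReach σ i h * (G.nodeValue σ i (h ++ [a]) - G.nodeValue σ i h)| :=
        Finset.abs_sum_le_sum_abs _ _
    _ ≤ ∑ h ∈ G.members i I, G.otherReach σ i h * G.utilityRange i := by
        refine Finset.sum_le_sum fun h hh => ?_
        have hh1 := (mem_decisionNodes.1 (mem_members.1 hh).1).1
        rw [infoActions_eq hh] at ha
        have h1 := nodeValue_mem_Icc hσ i h hh1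
        have h2 := nodeValue_mem_Icc hσ i _ (GameTree.mem_actions.1 ha)
        have h0 := otherReach_nonneg (i := i) hσ hh1
        rw [abs_mul, abs_of_nonneg h0]
        refine mul_le_mul_of_nonneg_left ?_ h0
        rw [utilityRange, abs_le]
        constructor <;> linarith [h1.1, h1.2, h2.1, h2.2]
    _ ≤ G.utilityRange i := by
        rw [← Finset.sum_mul]
        exact mul_le_of_le_one_left (utilityRange_nonneg i) (hG.sum_otherReach_le_one hσ i I)

/-- The expected instantaneous regret at an information set vanishes under the strategy played. -/
theorem sum_mul_instRegret (hσ : G.IsProfile σ) (i : Fin 2) (I : K) :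
    ∑ a ∈ G.infoActions i I, σ i I a * G.instRegret σ i I a = 0 := by
  simp only [instRegret_eq, Finset.mul_sum]
  rw [Finset.sum_comm]
  refine Finset.sum_eq_zero fun h hh => ?_
  obtain ⟨hd, hi⟩ := mem_members.1 hh
  obtain ⟨hh1, hne, ht⟩ := mem_decisionNodes.1 hd
  rw [infoActions_eq hh]
  have h1 := nodeValue_step (σ := σ) (i := i) hne
  have h2 := sum_actProb hσ hh1 hne
  simp only [actProb_of_turn ht, hi] at h1 h2
  calc ∑ a ∈ G.actions h, σ i I a * (G.otherReach σ i h *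
        (G.nodeValue σ i (h ++ [a]) - G.nodeValue σ i h))
      = G.otherReach σ i h * (∑ a ∈ G.actions h, σ i I a * G.nodeValue σ i (h ++ [a]) -
          (∑ a ∈ G.actions h, σ i I a) * G.nodeValue σ i h) := by
        rw [Finset.sum_mul, ← Finset.sum_sub_distrib, Finset.mul_sum]
        exact Finset.sum_congr rfl fun a _ => by ring
    _ = 0 := by rw [h2, ← h1]; ring

/-- The gain of player `i` from deviating to `s`, as a sum of one-step gains at the histories where
player `i` moves. It telescopes the sum of the reach probabilities under the deviation times the
values under the original profile. -/
theorem expUtility_update_sub (s : K → A → ℝ) :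
    G.expUtility i (Function.update σ i s) - G.expUtility i σ =
      ∑ h ∈ G.decisionNodes i, G.reach (Function.update σ i s) h *
        (∑ a ∈ G.actions h, s (G.info h) a * G.nodeValue σ i (h ++ [a]) -
          G.nodeValue σ i h) := by
  set τ := Function.update σ i s with hτ
  have htel := GameTree.sum_hist_eq (G := G.toGameTree)
    fun h => G.reach τ h * G.nodeValue σ i h
  have hroot : G.reach τ [] * G.nodeValue σ i [] = G.expUtility i σ := by
    rw [nodeValue_nil]; simp [reach, pathProd]
  have hterm : G.expUtility i τ =
      ∑ h ∈ G.hist, if G.actions h = ∅ then G.reach τ h * G.nodeValue σ i h else 0 := by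
    rw [← Finset.sum_filter]
    exact Finset.sum_congr rfl fun z hz => by rw [nodeValue_terminal hz]
  rw [hroot] at htel
  rw [hterm, ← sub_eq_of_eq_add htel, decisionNodes, Finset.sum_filter,
    ← Finset.sum_sub_distrib, ← Finset.sum_sub_distrib]
  refine Finset.sum_congr rfl fun h _ => ?_
  have hchild : ∑ a ∈ G.actions h, G.reach τ (h ++ [a]) * G.nodeValue σ i (h ++ [a]) =
      G.reach τ h * ∑ a ∈ G.actions h, G.actProb τ h a * G.nodeValue σ i (h ++ [a]) := by
    rw [Finset.mul_sum]
    refine Finset.sum_congr rfl fun a _ => ?_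
    rw [reach, pathProd_concat, ← reach, mul_assoc]
  rw [hchild]
  rcases (G.actions h).eq_empty_or_nonempty with hE | hne
  · simp [hE]
  · rw [if_neg hne.ne_empty]
    by_cases ht : G.turn h = some i
    · rw [if_pos ⟨hne, ht⟩]
      simp only [actProb_of_turn ht, hτ, Function.update_self]
      ring
    · rw [if_neg fun hc => ht hc.2]
      simp only [hτ, actProb_update_of_turn_ne s ht]
      rw [← nodeValue_step hne]
      ring

/-- The gain from deviating to `s` at the histories of one information set: the common contribution
of the deviator to the reach probabilities factors out. -/
theorem PerfectRecall.sum_members_gain (hG : G.PerfectRecall) {s : K → A → ℝ}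
    (hs : G.IsStrategy i s) {h₀ : List A} (hh₀ : h₀ ∈ G.members i I) :
    ∑ h ∈ G.members i I, G.reach (Function.update σ i s) h *
        (∑ a ∈ G.actions h, s (G.info h) a * G.nodeValue σ i (h ++ [a]) -
          G.nodeValue σ i h) =
      G.ownReach (Function.update σ i s) i h₀ *
        ∑ a ∈ G.infoActions i I, s I a * G.instRegret σ i I a := by
  simp only [instRegret_eq, Finset.mul_sum]
  rw [Finset.sum_comm]
  refine Finset.sum_congr rfl fun h hh => ?_
  obtain ⟨hd, hi⟩ := mem_members.1 hh
  have h1 := (hs _ (info_mem_infoSets hd)).2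
  rw [infoActions_info hd, hi] at h1
  rw [infoActions_eq hh, reach_eq_own_mul_other i, otherReach_update, hG.ownReach_eq hh₀ hh, hi]
  calc _ = G.ownReach (Function.update σ i s) i h * G.otherReach σ i h *
        (∑ a ∈ G.actions h, s I a * G.nodeValue σ i (h ++ [a]) -
          (∑ a ∈ G.actions h, s I a) * G.nodeValue σ i h) := by rw [h1, one_mul]
    _ = _ := by
        rw [Finset.sum_mul, ← Finset.sum_sub_distrib, Finset.mul_sum]
        exact Finset.sum_congr rfl fun a _ => by ring

theorem expUtility_rev (σ : Fin 2 → K → A → ℝ) (i : Fin 2) :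
    G.expUtility i.rev σ = -G.expUtility i σ := by
  rw [eq_neg_iff_add_eq_zero, expUtility, expUtility, ← Finset.sum_add_distrib]
  refine Finset.sum_eq_zero fun z hz => ?_
  rw [← mul_add]
  have := G.zero_sum z hz
  fin_cases i
  · have h1 : G.utility 1 z + G.utility 0 z = 0 := by linarith
    exact mul_eq_zero_of_right _ h1
  · exact mul_eq_zero_of_right _ this

end Value

/-! ### The played strategies -/

section Normalize

/-- Normalizing nonnegative numbers, with the uniform distribution as the default, gives a
probability distribution. -/
theorem normalize_mem_simplex {S : Finset A} (hS : S.Nonempty) {x : A → ℝ}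
    (hx : ∀ a ∈ S, 0 ≤ x a) :
    (∀ a ∈ S, 0 ≤ if 0 < ∑ b ∈ S, x b then x a / ∑ b ∈ S, x b else 1 / (S.card : ℝ)) ∧
      ∑ a ∈ S, (if 0 < ∑ b ∈ S, x b then x a / ∑ b ∈ S, x b else 1 / (S.card : ℝ)) = 1 := by
  split_ifs with h
  · exact ⟨fun a ha => div_nonneg (hx a ha) h.le, by rw [← Finset.sum_div, div_self h.ne']⟩
  · refine ⟨fun a _ => by positivity, ?_⟩
    have : (S.card : ℝ) ≠ 0 := by exact_mod_cast hS.card_pos.ne'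
    rw [Finset.sum_const, nsmul_eq_mul, mul_one_div_cancel this]

theorem isProfile_regretMatching (R : Fin 2 → K → A → ℝ) :
    G.IsProfile (G.regretMatching R) := fun _ _ hI =>
  normalize_mem_simplex (infoActions_nonempty hI) fun _ _ => le_max_right _ _

theorem isProfile_iterate (α β : ℕ → ℝ) (t : ℕ) : G.IsProfile (G.iterate α β t) :=
  isProfile_regretMatching _

/-- The regret-matching strategy is orthogonal to its instantaneous regrets. -/
theorem sum_pos_mul_instRegret (R : Fin 2 → K → A → ℝ) (i : Fin 2) (I : K) :
    ∑ a ∈ G.infoActions i I, max (R i I a) 0 * G.instRegret (G.regretMatching R) i I a = 0 := by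
  by_cases hQ : 0 < ∑ a' ∈ G.infoActions i I, max (R i I a') 0
  · have h1 := sum_mul_instRegret (isProfile_regretMatching (G := G) R) i I
    have h2 : ∀ a, max (R i I a) 0 =
        (∑ a' ∈ G.infoActions i I, max (R i I a') 0) * G.regretMatching R i I a := by
      intro a
      rw [regretMatching, if_pos hQ, mul_div_cancel₀ _ hQ.ne']
    calc _ = ∑ a ∈ G.infoActions i I, (∑ a' ∈ G.infoActions i I, max (R i I a') 0) *
          (G.regretMatching R i I a * G.instRegret (G.regretMatching R) i I a) :=
          Finset.sum_congr rfl fun a _ => by rw [← mul_assoc, ← h2]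
      _ = 0 := by rw [← Finset.mul_sum, h1, mul_zero]
  · refine Finset.sum_eq_zero fun a ha => ?_
    have h0 : ∀ a ∈ G.infoActions i I, 0 ≤ max (R i I a) 0 := fun _ _ => le_max_right _ _
    have h1 := (Finset.sum_eq_zero_iff_of_nonneg h0).1
      (le_antisymm (not_lt.1 hQ) (Finset.sum_nonneg h0)) a ha
    rw [h1, zero_mul]

end Normalize

/-! ### The discount factors -/

section Discounts

/-- The discount factors of the cumulative strategy. -/
noncomputable def avgDiscount (γ : ℕ → ℝ) (t : ℕ) : ℝ :=
  ((t : ℝ) / ((t : ℝ) + 1)) ^ γ (t + 1)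

theorem avgDiscount_nonneg (γ : ℕ → ℝ) (t : ℕ) : 0 ≤ avgDiscount γ t :=
  Real.rpow_nonneg (by positivity) _

theorem avgDiscount_le_one {γ : ℕ → ℝ} {t : ℕ} (hγ : 0 ≤ γ (t + 1)) : avgDiscount γ t ≤ 1 :=
  Real.rpow_le_one (by positivity) (by rw [div_le_one (by positivity)]; linarith) hγ

theorem div_add_one_le_rpow_div {t : ℕ} {α : ℝ} (hα : 1 ≤ α) :
    (t : ℝ) / ((t : ℝ) + 1) ≤ (t : ℝ) ^ α / ((t : ℝ) ^ α + 1) := by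
  rcases Nat.eq_zero_or_pos t with rfl | ht
  · simp only [Nat.cast_zero, zero_div]; positivity
  · have h1 : (1 : ℝ) ≤ t := by exact_mod_cast ht
    have h2 : (t : ℝ) ≤ (t : ℝ) ^ α := by
      simpa using Real.rpow_le_rpow_of_exponent_le h1 hα
    rw [div_le_div_iff₀ (by positivity) (by positivity)]
    linarith

theorem rpow_div_le_half {t : ℕ} {β : ℝ} (hβ : β ≤ 0) :
    (t : ℝ) ^ β / ((t : ℝ) ^ β + 1) ≤ 1 / 2 := by
  have h1 : (t : ℝ) ^ β ≤ 1 := by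
    rcases Nat.eq_zero_or_pos t with rfl | ht
    · rw [Nat.cast_zero]; exact Real.zero_rpow_le_one β
    · exact Real.rpow_le_one_of_one_le_of_nonpos (by exact_mod_cast ht) hβ
  have h0 : (0 : ℝ) ≤ (t : ℝ) ^ β := by positivity
  rw [div_le_div_iff₀ (by positivity) (by positivity)]
  linarith

end Discounts

/-! ### Counterfactual regret -/

section Regret

variable {α β γ : ℕ → ℝ} {T : ℕ} {U : ℝ}

/-- The bound on the discounted regret at a single information set, with constants that are
uniform in the information set and the player. -/
noncomputable def regretBound (G : ZeroSumGame A K) (T : ℕ) : ℝ :=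
  G.maxRange * (8 / 3 * √(G.maxActions : ℝ) * √(T : ℝ) + 2)

theorem utilityRange_le_maxRange (i : Fin 2) : G.utilityRange i ≤ G.maxRange := by
  fin_cases i
  · exact le_max_left _ _
  · exact le_max_right _ _

theorem maxRange_nonneg : 0 ≤ G.maxRange :=
  (utilityRange_nonneg 0).trans (utilityRange_le_maxRange 0)

theorem regretBound_nonneg (T : ℕ) : 0 ≤ G.regretBound T :=
  mul_nonneg maxRange_nonneg (by positivity)

theorem PerfectRecall.discSum_instRegret_le (hG : G.PerfectRecall)
    (hα : ∀ t ∈ Finset.Icc 1 T, 1 ≤ α t) (hβ : ∀ t ∈ Finset.Icc 1 T, β t ≤ 0)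
    (hγ : ∀ t ∈ Finset.Icc 1 T, 0 ≤ γ t) (hI : I ∈ G.infoSets i)
    (ha : a ∈ G.infoActions i I) :
    discSum (avgDiscount γ) (fun t => G.instRegret (G.iterate α β t) i I a) T ≤
      G.regretBound T := by
  have hmem : ∀ t < T, t + 1 ∈ Finset.Icc 1 T := fun t ht => Finset.mem_Icc.2 ⟨by omega, ht⟩
  have h1 := discSum_regret_le (S := G.infoActions i I) (D := G.utilityRange i) (T := T)
    (dp := fun t => (t : ℝ) ^ α (t + 1) / ((t : ℝ) ^ α (t + 1) + 1))
    (dm := fun t => (t : ℝ) ^ β (t + 1) / ((t : ℝ) ^ β (t + 1) + 1))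
    (g := avgDiscount γ)
    (R := fun t a => G.cumRegret α β t i I a)
    (r := fun t a => G.instRegret (G.iterate α β t) i I a)
    (fun _ => rfl) (fun _ _ => rfl) (utilityRange_nonneg i)
    (fun t _ a ha => hG.abs_instRegret_le (isProfile_iterate α β t) ha)
    (fun t _ => sum_pos_mul_instRegret _ i I)
    (fun t ht => div_add_one_le_rpow_div (hα _ (hmem t ht)))
    (fun t _ => by
      rw [div_le_one (by positivity)]; linarith)
    (fun t _ => by positivity)
    (fun t ht => rpow_div_le_half (hβ _ (hmem t ht)))
    (fun t _ => avgDiscount_nonneg γ t)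
    (fun t ht => avgDiscount_le_one (hγ _ (hmem t ht))) ha
  refine h1.trans ?_
  have h2 : √((G.infoActions i I).card : ℝ) ≤ √(G.maxActions : ℝ) :=
    Real.sqrt_le_sqrt (by exact_mod_cast card_infoActions_le_maxActions hI)
  rw [regretBound]
  have h3 := maxRange_nonneg (G := G)
  gcongr
  exact utilityRange_le_maxRange i

/-- The counterfactual regret bound: the discounted regret of a player against any fixed strategy
is at most the sum of the discounted regrets at that player's information sets. -/
theorem PerfectRecall.discSum_gain_le (hG : G.PerfectRecall)
    (hα : ∀ t ∈ Finset.Icc 1 T, 1 ≤ α t) (hβ : ∀ t ∈ Finset.Icc 1 T, β t ≤ 0)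
    (hγ : ∀ t ∈ Finset.Icc 1 T, 0 ≤ γ t) {s : K → A → ℝ} (hs : G.IsStrategy i s) :
    discSum (avgDiscount γ) (fun t => G.expUtility i (Function.update (G.iterate α β t) i s) -
      G.expUtility i (G.iterate α β t)) T ≤ (G.infoSets i).card * G.regretBound T := by
  simp only [expUtility_update_sub]
  have hfib : ∀ F : List A → ℝ, ∑ h ∈ G.decisionNodes i, F h =
      ∑ I ∈ G.infoSets i, ∑ h ∈ G.members i I, F h := fun F =>
    (Finset.sum_fiberwise_of_maps_to (fun h hh => info_mem_infoSets hh) F).symm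
  simp only [hfib]
  rw [discSum_sum, ← nsmul_eq_mul]
  refine Finset.sum_le_card_nsmul _ _ _ fun I hI => ?_
  obtain ⟨h₀, hh₀⟩ := members_nonempty hI
  have hs' := hs I hI
  -- the deviator's own reach probability of `I` does not depend on the iteration
  have hown : ∀ t, G.ownReach (Function.update (G.iterate α β t) i s) i h₀ =
      G.ownReach (fun _ => s) i h₀ := fun t => ownReach_congr (by simp)
  have hh₀' := (mem_decisionNodes.1 (mem_members.1 hh₀).1).1
  have h0 : 0 ≤ G.ownReach (fun _ => s) i h₀ := ownReach_nonneg hs hh₀'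
  have h1 : G.ownReach (fun _ => s) i h₀ ≤ 1 := ownReach_le_one hs hh₀'
  simp only [hG.sum_members_gain hs hh₀, hown]
  rw [discSum_mul_left, discSum_sum]
  simp only [discSum_mul_left]
  have h2 : ∑ a ∈ G.infoActions i I,
      s I a * discSum (avgDiscount γ) (fun t => G.instRegret (G.iterate α β t) i I a) T ≤
      G.regretBound T := by
    calc _ ≤ ∑ a ∈ G.infoActions i I, s I a * G.regretBound T :=
          Finset.sum_le_sum fun a ha => mul_le_mul_of_nonneg_left
            (hG.discSum_instRegret_le hα hβ hγ hI ha) (hs'.1 a ha)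
      _ = G.regretBound T := by rw [← Finset.sum_mul, hs'.2, one_mul]
  exact (mul_le_mul_of_nonneg_left h2 h0).trans
    (mul_le_of_le_one_left (regretBound_nonneg T) h1)

end Regret

/-! ### The average strategy -/

section Average

variable {α β γ : ℕ → ℝ} {T : ℕ} {U : ℝ}

theorem cumStrategy_eq_discSum (T : ℕ) (i : Fin 2) (I : K) (a : A) :
    G.cumStrategy α β γ T i I a = discSum (avgDiscount γ)
      (fun t => G.ownInfoReach (G.iterate α β t) i I * G.iterate α β t i I a) T := by
  induction T with
  | zero => rfl
  | succ T ih => simp only [cumStrategy, discSum, ih, avgDiscount]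

theorem isProfile_avgStrategy (α β γ : ℕ → ℝ) (T : ℕ) : G.IsProfile (G.avgStrategy α β γ T) := by
  intro i I hI
  refine normalize_mem_simplex (infoActions_nonempty hI) fun a ha => ?_
  rw [cumStrategy_eq_discSum]
  refine discSum_nonneg (avgDiscount_nonneg γ) (fun t => mul_nonneg ?_ ?_) T
  · exact Finset.sum_nonneg fun h hh => ownReach_nonneg (isProfile_iterate α β t i)
      (mem_decisionNodes.1 (mem_members.1 hh).1).1
  · exact (isProfile_iterate α β t i I hI).1 a ha

/-- The average strategy realizes the weighted average of the own reach probabilities of the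
iterates. At an information set where the cumulative strategy vanishes, both sides are zero at all
later histories. -/
theorem PerfectRecall.ownReach_avgStrategy (hG : G.PerfectRecall) (i : Fin 2)
    (hh : h ∈ G.hist) :
    G.ownReach (G.avgStrategy α β γ T) i h * discSum (avgDiscount γ) (fun _ => 1) T =
      discSum (avgDiscount γ) (fun t => G.ownReach (G.iterate α β t) i h) T := by
  induction h using List.reverseRecOn with
  | nil => simp [ownReach, pathProd]
  | append_singleton h a ih =>
    have hh' := G.prefix_closed _ _ hh
    have ha : a ∈ G.actions h := GameTree.mem_actions.2 hh
    have ih' := ih hh'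
    have hcat : ∀ σ : Fin 2 → K → A → ℝ,
        G.ownReach σ i (h ++ [a]) = G.ownReach σ i h * G.ownProb σ i h a :=
      fun σ => pathProd_concat _ _ _
    simp only [hcat]
    by_cases ht : G.turn h = some i
    swap
    · simpa only [ownProb_of_turn_ne ht, mul_one] using ih'
    simp only [ownProb_of_turn ht]
    have hd := mem_decisionNodes_of_mem_actions hh' ht ha
    have hI := info_mem_infoSets hd
    have hm : h ∈ G.members i (G.info h) := mem_members.2 ⟨hd, rfl⟩
    set I := G.info h with hIdef
    have hcard : (0 : ℝ) < (G.members i I).card := by exact_mod_cast Finset.card_pos.2 ⟨h, hm⟩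
    have hC : ∀ b, G.cumStrategy α β γ T i I b = (G.members i I).card *
        discSum (avgDiscount γ)
          (fun t => G.ownReach (G.iterate α β t) i h * G.iterate α β t i I b) T := by
      intro b
      rw [cumStrategy_eq_discSum, ← discSum_mul_left]
      simp only [hG.ownInfoReach_eq hm, mul_assoc]
    have hsum : ∑ b ∈ G.infoActions i I, G.cumStrategy α β γ T i I b =
        (G.members i I).card *
          discSum (avgDiscount γ) (fun t => G.ownReach (G.iterate α β t) i h) T := by
      simp only [hC]
      rw [← Finset.mul_sum, ← discSum_sum]
      simp only [← Finset.mul_sum, (isProfile_iterate α β _ i I hI).2, mul_one]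
    have hreach : ∀ t, 0 ≤ G.ownReach (G.iterate α β t) i h := fun t =>
      ownReach_nonneg (isProfile_iterate α β t i) hh'
    have hpos := discSum_nonneg (avgDiscount_nonneg γ) hreach T
    rw [mul_right_comm, ih', avgStrategy, hsum]
    split_ifs with hQ
    · rw [hC]
      have : discSum (avgDiscount γ) (fun t => G.ownReach (G.iterate α β t) i h) T ≠ 0 := by
        intro h0; rw [h0, mul_zero] at hQ; exact lt_irrefl _ hQ
      field_simp
    · have h0 : discSum (avgDiscount γ) (fun t => G.ownReach (G.iterate α β t) i h) T = 0 :=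
        le_antisymm (not_lt.1 fun hc => hQ (mul_pos hcard hc)) hpos
      rw [h0, zero_mul]
      rw [infoActions_info hd |>.symm] at ha
      have hs := fun t => isProfile_iterate (G := G) α β t i I hI
      refine le_antisymm (discSum_nonneg (avgDiscount_nonneg γ)
        (fun t => mul_nonneg (hreach t) ((hs t).1 a ha)) T) ?_
      rw [← h0]
      refine discSum_mono (avgDiscount_nonneg γ) (fun t => ?_) T
      exact mul_le_of_le_one_right (hreach t)
        ((hs t).2 ▸ Finset.single_le_sum (f := fun b => G.iterate α β t i I b) (hs t).1 ha)

/-- Against a fixed strategy `s` of player `i`, the average strategy of the opponent does as well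
as the weighted average of the opponent's iterates. -/
theorem PerfectRecall.expUtility_update_avgStrategy (hG : G.PerfectRecall) (i j : Fin 2)
    (s : K → A → ℝ) :
    G.expUtility j (Function.update (G.avgStrategy α β γ T) i s) *
        discSum (avgDiscount γ) (fun _ => 1) T =
      discSum (avgDiscount γ)
        (fun t => G.expUtility j (Function.update (G.iterate α β t) i s)) T := by
  have hne : i.rev ≠ i := by fin_cases i <;> decide
  have hu : ∀ σ : Fin 2 → K → A → ℝ, G.expUtility j (Function.update σ i s) =
      ∑ z ∈ G.terminal, (G.ownReach (fun _ => s) i z * G.chanceReach z * G.utility j z) *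
        G.ownReach σ i.rev z := by
    intro σ
    refine Finset.sum_congr rfl fun z _ => ?_
    rw [reach_eq_own_mul_own i,
      ownReach_congr (σ := Function.update σ i s) (τ := fun _ => s) (by simp),
      ownReach_congr (i := i.rev) (σ := Function.update σ i s) (τ := σ)
        (Function.update_of_ne hne _ _)]
    ring
  simp only [hu]
  rw [discSum_sum, Finset.sum_mul]
  refine Finset.sum_congr rfl fun z hz => ?_
  rw [discSum_mul_left, mul_assoc, hG.ownReach_avgStrategy _ (Finset.mem_filter.1 hz).1]

/-- The folk theorem behind the convergence of regret minimization in zero-sum games: whatever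
deviations `s` and `s'` the two players use against the average strategies, they gain in total at
most the sum of the average regrets of the two players. -/
theorem PerfectRecall.expUtility_sub_le (hG : G.PerfectRecall) (hT : 1 ≤ T)
    (hα : ∀ t ∈ Finset.Icc 1 T, 1 ≤ α t) (hβ : ∀ t ∈ Finset.Icc 1 T, β t ≤ 0)
    (hγ : ∀ t ∈ Finset.Icc 1 T, γ t ∈ Set.Icc (0 : ℝ) U) {s s' : K → A → ℝ}
    (hs : G.IsStrategy i s) (hs' : G.IsStrategy i.rev s') :
    G.expUtility i (Function.update (G.avgStrategy α β γ T) i s) -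
        G.expUtility i (Function.update (G.avgStrategy α β γ T) i.rev s') ≤
      (U + 1) * G.maxRange * (G.numInfoSets : ℝ) *
        (8 / 3 * √(G.maxActions : ℝ) + 2 / √(T : ℝ)) / √(T : ℝ) := by
  have hγ0 : ∀ t ∈ Finset.Icc 1 T, 0 ≤ γ t := fun t ht => (hγ t ht).1
  have hU : 0 ≤ U := by
    have := hγ 1 (Finset.mem_Icc.2 ⟨le_rfl, hT⟩)
    exact this.1.trans this.2
  have hP : (T : ℝ) / (U + 1) ≤ discSum (avgDiscount γ) (fun _ => 1) T :=
    div_le_discSum_one hU fun t ht => (hγ t ht).2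
  set P := discSum (avgDiscount γ) (fun _ => 1) T
  set d := G.expUtility i (Function.update (G.avgStrategy α β γ T) i s) -
    G.expUtility i (Function.update (G.avgStrategy α β γ T) i.rev s') with hd
  have hT0 : (0 : ℝ) < T := by exact_mod_cast hT
  have hcard : ((G.infoSets i).card : ℝ) + (G.infoSets i.rev).card = G.numInfoSets := by
    rw [numInfoSets, Fin.sum_univ_two]
    push_cast
    fin_cases i
    · rfl
    · exact add_comm _ _
  have hdP : d * P ≤ G.numInfoSets * G.regretBound T := by
    have h1 := hG.discSum_gain_le hα hβ hγ0 hs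
    have h2 := hG.discSum_gain_le hα hβ hγ0 hs'
    have h3 := hG.expUtility_update_avgStrategy (α := α) (β := β) (γ := γ) (T := T) i i s
    have h4 := hG.expUtility_update_avgStrategy (α := α) (β := β) (γ := γ) (T := T)
      i.rev i.rev s'
    rw [expUtility_rev] at h4
    have h5 : d * P = discSum (avgDiscount γ)
          (fun t => G.expUtility i (Function.update (G.iterate α β t) i s) -
            G.expUtility i (G.iterate α β t)) T +
        discSum (avgDiscount γ)
          (fun t => G.expUtility i.rev (Function.update (G.iterate α β t) i.rev s') -
            G.expUtility i.rev (G.iterate α β t)) T := by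
      rw [hd, sub_mul, sub_eq_add_neg, ← neg_mul, h3, h4, ← discSum_add, ← discSum_add]
      congr 1
      funext t
      rw [expUtility_rev (G.iterate α β t)]
      ring
    rw [h5, ← hcard, add_mul]
    exact add_le_add h1 h2
  have hrhs : (U + 1) * G.maxRange * (G.numInfoSets : ℝ) *
      (8 / 3 * √(G.maxActions : ℝ) + 2 / √(T : ℝ)) / √(T : ℝ) =
      G.numInfoSets * G.regretBound T / (T / (U + 1)) := by
    have hsq : √(T : ℝ) ^ 2 = T := Real.sq_sqrt hT0.le
    have hpos : 0 < √(T : ℝ) := Real.sqrt_pos.2 hT0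
    have hU1 : U + 1 ≠ 0 := by linarith
    rw [regretBound]
    conv_rhs => rw [← hsq]
    rw [Real.sqrt_sq hpos.le]
    field_simp
  rw [hrhs]
  have hTU : 0 < (T : ℝ) / (U + 1) := by positivity
  rw [le_div_iff₀ hTU]
  have hB : 0 ≤ G.numInfoSets * G.regretBound T :=
    mul_nonneg (Nat.cast_nonneg _) (regretBound_nonneg T)
  rcases le_total d 0 with h0 | h0
  · exact (mul_nonpos_of_nonpos_of_nonneg h0 hTU.le).trans hB
  · exact (mul_le_mul_of_nonneg_left hP h0).trans hdP

end Average

end ZeroSumGame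

theorem theorem3p1 {A K : Type*} [Fintype A] [DecidableEq A] [DecidableEq K]
    (G : ZeroSumGame A K) (hG : G.PerfectRecall)
    (T : ℕ) (hT : 1 ≤ T) (U : ℝ) (α β γ : ℕ → ℝ)
    (hα : ∀ t ∈ Finset.Icc 1 T, α t ∈ Set.Icc (1 : ℝ) 5)
    (hβ : ∀ t ∈ Finset.Icc 1 T, β t ∈ Set.Icc (-5 : ℝ) 0)
    (hγ : ∀ t ∈ Finset.Icc 1 T, γ t ∈ Set.Icc (0 : ℝ) U)
    (ε : ℝ)
    (hε : ε = (U + 1) * G.maxRange * (G.numInfoSets : ℝ) *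
      (8 / 3 * √(G.maxActions : ℝ) + 2 / √(T : ℝ)) / √(T : ℝ)) :
    G.IsEpsNash ε (G.avgStrategy α β γ T) ∧
      ∀ i, G.ExploitabilityLE ε (G.avgStrategy α β γ T) i := by
  have hprof := ZeroSumGame.isProfile_avgStrategy (G := G) α β γ T
  have key : ∀ i s s', G.IsStrategy i s → G.IsStrategy i.rev s' →
      G.expUtility i (Function.update (G.avgStrategy α β γ T) i s) -
        G.expUtility i (Function.update (G.avgStrategy α β γ T) i.rev s') ≤ ε :=
    fun i s s' hs hs' => hε ▸ hG.expUtility_sub_le hT (fun t ht => (hα t ht).1)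
      (fun t ht => (hβ t ht).2) hγ hs hs'
  refine ⟨⟨hprof, fun i s hs => ?_⟩, fun i σs hσs bs b hbs hb => ?_⟩
  · have h1 := key i s _ hs (hprof i.rev)
    rw [Function.update_eq_self] at h1
    linarith
  · -- the best response to `σs i` holds player `i` to at most what `σs i` earns against the average
    -- strategy of the opponent
    have h1 := hbs.2 _ (hprof i.rev)
    rw [ZeroSumGame.expUtility_rev, ZeroSumGame.expUtility_rev] at h1
    have h2 := key i _ b (hσs.1 i) hb.1
    have h3 : Function.update σs i.rev (G.avgStrategy α β γ T i.rev) =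
        Function.update (G.avgStrategy α β γ T) i (σs i) := by
      funext j
      fin_cases i <;> fin_cases j <;> rfl
    rw [h3] at h1
    linarith
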